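/- Let $(\mathcal C,\mathbb E,\mathfrak s)$ be a small extriangulated category: $\mathcal C$ is additive, $\mathbb E\colon\mathcal C^{op}\times\mathcal C\to Ab$ is biadditive, and $\mathfrak s$ assigns to each $\delta\in\mathbb E(C,A)$ an equivalence class of sequences $A\to B\to C$ (a conflation realizing $\delta$, whose first and second morphisms are called an $\mathfrak s$-inflation and an $\mathfrak s$-deflation). Let $\mathscr S$ be a class of morphisms of $\mathcal C$ that contains all isomorphisms and is closed under composition and finite direct sums. Let $\mathcal N_{\mathscr S}$ be the full subcategory of the objects $N$ such that both $N\to 0$ and $0\to N$ belong to $\mathscr S$, let $[\mathcal N_{\mathscr S}]$ be the ideal of morphisms that factor through an object of $\mathcal N_{\mathscr S}$, let $p\colon\mathcal C\to\overline{\mathcal C}=\mathcal C/[\mathcal N_{\mathscr S}]$, $f\mapsto\overline f$, be the ideal quotient, and let $\overline{\mathscr S}$ be the closure of $p(\mathscr S)$ under composition with isomorphisms of $\overline{\mathcal C}$. Assume: (MR1) $\overline{\mathscr S}$ satisfies the 2-out-of-3 property for composition; (MR2) $\overline{\mathscr S}$ is a multiplicative system in $\overline{\mathcal C}$ (it admits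 left and right calculi of fractions); (MR3) if $A\xrightarrow{x}B\xrightarrow{y}C$ realizes $\delta$, $A'\xrightarrow{x'}B'\xrightarrow{y'}C'$ realizes $\delta'$, and $a\colon A\to A'$, $c\colon C\to C'$ satisfy $a_*\delta=c^*\delta'$ and $\overline a,\overline c\in\overline{\mathscr S}$, then there is $\mathbf b\colon B\to B'$ in $\overline{\mathscr S}$ with $\mathbf b\,\overline x=\overline{x}'\,\overline a$ and $\overline c\,\overline y=\overline{y}'\,\mathbf b$; (MR4) the class $\{\mathbf v\,\overline x\,\mathbf u\mid x\text{ an }\mathfrak s\text{-inflation},\ \mathbf u,\mathbf v\in\overline{\mathscr S}\}$ is closed under composition, and so is the class defined in the same way from $\mathfrak s$-deflations. Let $\overline Q\colon\overline{\mathcal C}\to\widetilde{\mathcal C}$ be the localization at $\overline{\mathscr S}$ and $Q=\overline Q\circ p$, which is the localization of $\mathcal C$ at $\mathscr S$. Let $\widetilde{\mathbb E}(C,A)$ be the set of classes $[t,\delta,s]$ of triples consisting of $t\colon Z\to C$ and $s\colon A\to X$ in $\overline{\mathscr S}$ and $\delta\in\mathbb E(Z,X)$. Here $[t_1,\delta_1,s_1]=[t_2,\delta_2,s_2]$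 if and only if there are morphisms $v_i\colon Z\to Z_i$ and $u_i\colon X_i\to X$ of $\mathcal C$ with $\overline{v}_i,\overline{u}_i\in\overline{\mathscr S}$ such that $t_1\overline{v}_1=t_2\overline{v}_2$, $\overline{u}_1s_1=\overline{u}_2s_2$, and $r_*(v_1^*u_{1*}\delta_1-v_2^*u_{2*}\delta_2)=0$ for some $r$ with $\overline r\in\overline{\mathscr S}$. It is a biadditive functor on $\widetilde{\mathcal C}^{op}\times\widetilde{\mathcal C}$ with the sum $[t,\delta_1,s]+[t,\delta_2,s]=[t,\delta_1+\delta_2,s]$ and the following actions. If $\alpha=\overline Q(u)^{-1}\overline Q(a)$ with $u\in\overline{\mathscr S}$, and $\overline{a'}s=s'a$ with $s'\in\overline{\mathscr S}$, then $\alpha_*[t,\delta,s]=[t,a'_*\delta,s'u]$. If $\gamma=\overline Q(c)\overline Q(v)^{-1}$ with $v\in\overline{\mathscr S}$, and $t\,\overline{c'}=c\,t'$ with $t'\in\overline{\mathscr S}$, then $\gamma^*[t,\delta,s]=[vt',c'^*\delta,s]$. Let $\widetilde{\mathfrak s}[t,\delta,s]$ be the class of $A\xrightarrow{Q(x)\overline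 Q(s)}Y\xrightarrow{\overline Q(t)Q(y)}C$, where $X\xrightarrow{x}Y\xrightarrow{y}Z$ realizes $\delta$. Suppose moreover that the following conditions hold. (i) If $x\colon A\to B$ is an $\mathfrak s$-inflation and $f\colon X\to A$ satisfies $xf=0$, then $f\in[\mathcal N_{\mathscr S}]$. Dually, if $y\colon B\to C$ is an $\mathfrak s$-deflation and $g\colon C\to X$ satisfies $gy=0$, then $g\in[\mathcal N_{\mathscr S}]$. (ii) For any $N\in\mathcal N_{\mathscr S}$ and any $f\colon A\to N$ there is a morphism $s\colon A'\to A$ of $\mathcal C$ with $fs=0$ and $Q(s)$ invertible. Dually, for any $f\colon N\to A$ there is $s\colon A\to A'$ with $sf=0$ and $Q(s)$ invertible. Then the localization $(\widetilde{\mathcal C},\widetilde{\mathbb E},\widetilde{\mathfrak s})$ corresponds to an exact category: it is a (well-defined) extriangulated category in which every $\widetilde{\mathfrak s}$-inflation is a monomorphism and every $\widetilde{\mathfrak s}$-deflation is an epimorphism. If moreover every morphism $f$ of $\mathcal C$ is $\mathfrak s$-admissible, i.e. $f=me$ with $e$ an $\mathfrak s$-deflation and $m$ an $\mathfrak s$-inflation,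 then $\widetilde{\mathcal C}$ is an abelian category. -/

import Mathlib

open CategoryTheory CategoryTheory.Limits Opposite

universe w v u

namespace Extriangulated

section Basic

variable {C : Type u} [Category.{v} C] [Preadditive C]

/-! ### Extensions

A biadditive functor `Cᵒᵖ × C ⥤ Ab` is given in curried form, as a functor
`E : Cᵒᵖ ⥤ C ⥤ AddCommGrpCat` that is additive in each variable. -/

/-- The group `E(Z, A)` of extensions `Z ⇢ A`. -/
abbrev Ext (E : Cᵒᵖ ⥤ C ⥤ AddCommGrpCat.{w}) (Z A : C) : Type w :=
  ((E.obj (op Z)).obj A : AddCommGrpCat.{w})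

/-- The push-forward `a_* δ = E(Z, a)(δ)`. -/
def push (E : Cᵒᵖ ⥤ C ⥤ AddCommGrpCat.{w}) {Z A A' : C} (a : A ⟶ A') (δ : Ext E Z A) :
    Ext E Z A' :=
  (E.obj (op Z)).map a δ

/-- The pull-back `c^* δ = E(c, A)(δ)`. -/
def pull (E : Cᵒᵖ ⥤ C ⥤ AddCommGrpCat.{w}) {Z Z' A : C} (c : Z' ⟶ Z) (δ : Ext E Z A) :
    Ext E Z' A :=
  (E.map c.op).app A δ

/-- `E` is additive in each of its two variables. -/
structure IsBiadditive (E : Cᵒᵖ ⥤ C ⥤ AddCommGrpCat.{w}) : Prop where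
  left : E.Additive
  right : ∀ Z : Cᵒᵖ, (E.obj Z).Additive

/-! ### Realizations -/

/-- Two sequences `A ⟶ B ⟶ Z` and `A ⟶ B' ⟶ Z` with the same ends are equivalent. -/
def SeqEquiv {A B B' Z : C} (x : A ⟶ B) (y : B ⟶ Z) (x' : A ⟶ B') (y' : B' ⟶ Z) : Prop :=
  ∃ b : B ≅ B', x ≫ b.hom = x' ∧ b.hom ≫ y' = y

/-- The type of relations "the sequence `A ⟶ B ⟶ Z` belongs to the class `s(δ)`". -/
abbrev Realization (E : Cᵒᵖ ⥤ C ⥤ AddCommGrpCat.{w}) : Type (max u v w) :=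
  ∀ ⦃A B Z : C⦄, (A ⟶ B) → (B ⟶ Z) → Ext E Z A → Prop

variable {E : Cᵒᵖ ⥤ C ⥤ AddCommGrpCat.{w}}

/-- The relation `s` comes from a map that assigns to each extension exactly one equivalence
class of sequences. -/
structure IsClassAssignment (s : Realization E) : Prop where
  exists_seq : ∀ {A Z : C} (δ : Ext E Z A), ∃ (B : C) (x : A ⟶ B) (y : B ⟶ Z), s x y δ
  iff_equiv : ∀ {A B B' Z : C} {δ : Ext E Z A} {x : A ⟶ B} {y : B ⟶ Z}, s x y δ →
    ∀ (x' : A ⟶ B') (y' : B' ⟶ Z), s x' y' δ ↔ SeqEquiv x y x' y'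

/-- `x` is the first morphism of some conflation. -/
def IsInflation (s : Realization E) {A B : C} (x : A ⟶ B) : Prop :=
  ∃ (Z : C) (y : B ⟶ Z) (δ : Ext E Z A), s x y δ

/-- `y` is the second morphism of some conflation. -/
def IsDeflation (s : Realization E) {B Z : C} (y : B ⟶ Z) : Prop :=
  ∃ (A : C) (x : A ⟶ B) (δ : Ext E Z A), s x y δ

/-- `f` is a deflation followed by an inflation. -/
def IsAdmissible (s : Realization E) {A B : C} (f : A ⟶ B) : Prop :=
  ∃ (I : C) (e : A ⟶ I) (m : I ⟶ B), IsDeflation s e ∧ IsInflation s m ∧ e ≫ m = f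

/-! ### Extriangulated categories -/

/-- `(C, E, s)` is a weakly extriangulated category. -/
structure IsWeaklyExtriangulated [HasZeroObject C] [HasBinaryBiproducts C]
    (E : Cᵒᵖ ⥤ C ⥤ AddCommGrpCat.{w}) (s : Realization E) : Prop where
  biadditive : IsBiadditive E
  assignment : IsClassAssignment s
  exact_comp_left : ∀ {A B Z : C} {x : A ⟶ B} {y : B ⟶ Z} {δ : Ext E Z A}, s x y δ → ∀ X : C,
    Function.Exact (fun h : X ⟶ A => h ≫ x) (fun g : X ⟶ B => g ≫ y) ∧
    Function.Exact (fun g : X ⟶ B => g ≫ y) (fun f : X ⟶ Z => pull E f δ)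
  exact_comp_right : ∀ {A B Z : C} {x : A ⟶ B} {y : B ⟶ Z} {δ : Ext E Z A}, s x y δ → ∀ X : C,
    Function.Exact (fun h : Z ⟶ X => y ≫ h) (fun g : B ⟶ X => x ≫ g) ∧
    Function.Exact (fun g : B ⟶ X => x ≫ g) (fun f : A ⟶ X => push E f δ)
  zero_right : ∀ (A Z : C), IsZero Z → s (𝟙 A) (0 : A ⟶ Z) (0 : Ext E Z A)
  zero_left : ∀ (A Z : C), IsZero A → s (0 : A ⟶ Z) (𝟙 Z) (0 : Ext E Z A)
  push_square : ∀ {A B Z A' B' : C} {x : A ⟶ B} {y : B ⟶ Z} {δ : Ext E Z A} (a : A ⟶ A')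
    {x' : A' ⟶ B'} {y' : B' ⟶ Z}, s x y δ → s x' y' (push E a δ) →
    ∃ b : B ⟶ B', x ≫ b = a ≫ x' ∧ b ≫ y' = y ∧
      s (biprod.lift x a) (biprod.desc b (-x')) (pull E y' δ)
  pull_square : ∀ {A B Z B' Z' : C} {x : A ⟶ B} {y : B ⟶ Z} {δ : Ext E Z A} (c : Z' ⟶ Z)
    {x' : A ⟶ B'} {y' : B' ⟶ Z'}, s x y δ → s x' y' (pull E c δ) →
    ∃ b : B' ⟶ B, x' ≫ b = x ∧ b ≫ y = y' ≫ c ∧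
      s (biprod.lift (-y') b) (biprod.desc c y) (push E x' δ)

/-- `(C, E, s)` is an extriangulated category. -/
structure IsExtriangulated [HasZeroObject C] [HasBinaryBiproducts C]
    (E : Cᵒᵖ ⥤ C ⥤ AddCommGrpCat.{w}) (s : Realization E) : Prop
    extends IsWeaklyExtriangulated E s where
  inflation_comp : ∀ {X Y Z : C} (f : X ⟶ Y) (g : Y ⟶ Z),
    IsInflation s f → IsInflation s g → IsInflation s (f ≫ g)
  deflation_comp : ∀ {X Y Z : C} (f : X ⟶ Y) (g : Y ⟶ Z),
    IsDeflation s f → IsDeflation s g → IsDeflation s (f ≫ g)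

/-- The extriangulated category `(C, E, s)` corresponds to an exact category. -/
structure CorrespondsToExact [HasZeroObject C] [HasBinaryBiproducts C]
    (E : Cᵒᵖ ⥤ C ⥤ AddCommGrpCat.{w}) (s : Realization E) : Prop where
  extriangulated : IsExtriangulated E s
  mono_of_inflation : ∀ {A B : C} (x : A ⟶ B), IsInflation s x → Mono x
  epi_of_deflation : ∀ {B Z : C} (y : B ⟶ Z), IsDeflation s y → Epi y

end Basic

section Quotient

variable {C : Type u} [Category.{v} C] [Preadditive C] [HasZeroObject C] [HasBinaryBiproducts C]

/-! ### The class `S`, the null objects and the ideal quotient -/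

/-- `S` contains all isomorphisms, and is closed under composition and finite direct sums. -/
class IsSumClosed (S : MorphismProperty C) : Prop where
  of_isIso : ∀ {X Y : C} (f : X ⟶ Y), IsIso f → S f
  comp : ∀ {X Y Z : C} (f : X ⟶ Y) (g : Y ⟶ Z), S f → S g → S (f ≫ g)
  sum : ∀ {X₁ X₂ Y₁ Y₂ : C} (f₁ : X₁ ⟶ Y₁) (f₂ : X₂ ⟶ Y₂), S f₁ → S f₂ → S (biprod.map f₁ f₂)

open ZeroObject in
/-- The objects `N` of `N_S`: both `N ⟶ 0` and `0 ⟶ N` belong to `S`. -/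
def IsNull (S : MorphismProperty C) (N : C) : Prop :=
  S (0 : N ⟶ (0 : C)) ∧ S (0 : (0 : C) ⟶ N)

/-- The ideal `[N_S]` of the morphisms that factor through an object of `N_S`. -/
def FactorsThroughNull (S : MorphismProperty C) {X Y : C} (f : X ⟶ Y) : Prop :=
  ∃ (N : C) (i : X ⟶ N) (j : N ⟶ Y), IsNull S N ∧ i ≫ j = f

/-- Two morphisms are identified in the ideal quotient when their difference is in `[N_S]`. -/
def idealRel (S : MorphismProperty C) : HomRel C :=
  fun _ _ f g => FactorsThroughNull S (f - g)

variable (S : MorphismProperty C)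

open ZeroObject in
theorem isNull_zero [IsSumClosed S] : IsNull S (0 : C) :=
  ⟨IsSumClosed.of_isIso _ (by rw [← id_zero]; infer_instance),
    IsSumClosed.of_isIso _ (by rw [← id_zero]; infer_instance)⟩

open ZeroObject in
theorem IsNull.biprod {S : MorphismProperty C} [IsSumClosed S] {N N' : C} (h : IsNull S N)
    (h' : IsNull S N') : IsNull S (N ⊞ N') := by
  have hz : IsZero ((0 : C) ⊞ (0 : C)) := by
    rw [IsZero.iff_id_eq_zero]
    apply biprod.hom_ext <;> exact (isZero_zero C).eq_of_tgt _ _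
  have i₁ : IsIso (0 : (0 : C) ⊞ (0 : C) ⟶ (0 : C)) :=
    ⟨0, hz.eq_of_src _ _, (isZero_zero C).eq_of_src _ _⟩
  have i₂ : IsIso (0 : (0 : C) ⟶ (0 : C) ⊞ (0 : C)) :=
    ⟨0, (isZero_zero C).eq_of_src _ _, hz.eq_of_src _ _⟩
  constructor
  · have := IsSumClosed.comp _ _ (IsSumClosed.sum _ _ h.1 h'.1) (IsSumClosed.of_isIso _ i₁)
    simpa using this
  · have := IsSumClosed.comp _ _ (IsSumClosed.of_isIso _ i₂) (IsSumClosed.sum _ _ h.2 h'.2)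
    simpa using this

variable {S} in
theorem FactorsThroughNull.add [IsSumClosed S] {X Y : C} {f g : X ⟶ Y}
    (hf : FactorsThroughNull S f) (hg : FactorsThroughNull S g) :
    FactorsThroughNull S (f + g) := by
  obtain ⟨N, i, j, hN, rfl⟩ := hf
  obtain ⟨N', i', j', hN', rfl⟩ := hg
  exact ⟨N ⊞ N', biprod.lift i i', biprod.desc j j', hN.biprod hN', by simp⟩

instance [IsSumClosed S] : Congruence (idealRel S) where
  equivalence :=
    { refl := fun f => ⟨_, 0, 0, isNull_zero S, by simp⟩
      symm := by
        rintro f g ⟨N, i, j, hN, h⟩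
        exact ⟨N, i, -j, hN, by simp [h]⟩
      trans := by
        intro f g h hfg hgh
        have := hfg.add hgh
        rwa [sub_add_sub_cancel] at this }
  comp_left := by
    rintro X Y Z f g g' ⟨N, i, j, hN, h⟩
    exact ⟨N, f ≫ i, j, hN, by simp [h]⟩
  comp_right := by
    rintro X Y Z f f' g ⟨N, i, j, hN, h⟩
    exact ⟨N, i, j ≫ g, hN, by rw [← Category.assoc, h, Preadditive.sub_comp]⟩

theorem idealRel_add [IsSumClosed S] ⦃X Y : C⦄ (f₁ f₂ g₁ g₂ : X ⟶ Y)
    (hf : idealRel S f₁ f₂) (hg : idealRel S g₁ g₂) : idealRel S (f₁ + g₁) (f₂ + g₂) := by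
  have := FactorsThroughNull.add hf hg
  rwa [sub_add_sub_comm] at this

/-- The ideal quotient `C / [N_S]`. -/
abbrev IdealQuotient : Type u := CategoryTheory.Quotient (idealRel S)

/-- The projection `p : C ⥤ C / [N_S]`. -/
abbrev proj : C ⥤ IdealQuotient S := CategoryTheory.Quotient.functor (idealRel S)

/-- The closure of `p(S)` under composition with isomorphisms of `C / [N_S]`. -/
abbrev closureS : MorphismProperty (IdealQuotient S) := S.map (proj S)

/-- The localization of `C / [N_S]` at `closureS S`, which is the localization of `C` at `S`. -/
abbrev Loc : Type u := (closureS S).Localization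

/-- The localization functor from the ideal quotient. -/
noncomputable abbrev QBar : IdealQuotient S ⥤ Loc S := (closureS S).Q

/-- The localization functor `Q : C ⥤ Loc S`. -/
noncomputable abbrev Q : C ⥤ Loc S := proj S ⋙ QBar S

variable {S}

/-- The object of the ideal quotient that underlies an object of the localization; objects of
`C`, of the ideal quotient and of the localization are the same. -/
noncomputable def under (X : Loc S) : IdealQuotient S :=
  (Localization.Construction.objEquiv (closureS S)).symm X

/-- The image in the localization of a morphism of the ideal quotient. -/
noncomputable def toLoc {X Y : Loc S} (f : under X ⟶ under Y) : X ⟶ Y := (QBar S).map f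

variable (S)

noncomputable instance [IsSumClosed S] : Preadditive (IdealQuotient S) :=
  CategoryTheory.Quotient.preadditive (idealRel S) (idealRel_add S)

instance [IsSumClosed S] : (proj S).Additive :=
  CategoryTheory.Quotient.functor_additive (idealRel S) (idealRel_add S)

instance [IsSumClosed S] : HasZeroObject (IdealQuotient S) :=
  (proj S).hasZeroObject_of_additive

instance [IsSumClosed S] : HasBinaryBiproducts (IdealQuotient S) where
  has_binary_biproduct X Y := by
    obtain ⟨X⟩ := X
    obtain ⟨Y⟩ := Y
    have := preservesBinaryBiproducts_of_preservesBiproducts (proj S)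
    exact inferInstanceAs (HasBinaryBiproduct ((proj S).obj X) ((proj S).obj Y))

instance [IsSumClosed S] [(closureS S).HasLeftCalculusOfFractions] :
    HasBinaryBiproducts (Loc S) where
  has_binary_biproduct X Y :=
    have := preservesBinaryBiproducts_of_preservesBiproducts (QBar S)
    inferInstanceAs (HasBinaryBiproduct ((QBar S).obj (under X)) ((QBar S).obj (under Y)))

end Quotient

section Localization

variable {C : Type u} [Category.{v} C] [Preadditive C] [HasZeroObject C] [HasBinaryBiproducts C]
  (E : Cᵒᵖ ⥤ C ⥤ AddCommGrpCat.{w}) (S : MorphismProperty C)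

/-! ### The localized extensions -/

variable {S} in
/-- A triple `Z₀ ⟵ Z ⇢ X ⟵ A₀` whose solid arrows `t`, `s` lie in `closureS S`. -/
structure Triple (Z₀ A₀ : Loc S) where
  {Z X : C}
  t : (proj S).obj Z ⟶ under Z₀
  ht : closureS S t
  δ : Ext E Z X
  s : under A₀ ⟶ (proj S).obj X
  hs : closureS S s

variable {E} in
/-- `δ` is killed by pushing forward along a morphism of `C` with class in `closureS S`. -/
def IsKilled {Z A : C} (δ : Ext E Z A) : Prop :=
  ∃ (A' : C) (a : A ⟶ A'), closureS S ((proj S).map a) ∧ push E a δ = 0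

variable {S E} in
/-- Two triples are identified when they become equal over a common denominator, where
extensions of `C` are compared up to extensions killed by `S`. -/
def TripleRel {Z₀ A₀ : Loc S} (τ₁ τ₂ : Triple E Z₀ A₀) : Prop :=
  ∃ (Z X : C) (v₁ : Z ⟶ τ₁.Z) (v₂ : Z ⟶ τ₂.Z) (u₁ : τ₁.X ⟶ X) (u₂ : τ₂.X ⟶ X),
    closureS S ((proj S).map v₁) ∧ closureS S ((proj S).map v₂) ∧
    closureS S ((proj S).map u₁) ∧ closureS S ((proj S).map u₂) ∧
    (proj S).map v₁ ≫ τ₁.t = (proj S).map v₂ ≫ τ₂.t ∧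
    τ₁.s ≫ (proj S).map u₁ = τ₂.s ≫ (proj S).map u₂ ∧
    IsKilled S (pull E v₁ (push E u₁ τ₁.δ) - pull E v₂ (push E u₂ τ₂.δ))

variable {S} in
/-- The set of extensions `Z₀ ⇢ A₀` in the localization. -/
def LocExt (Z₀ A₀ : Loc S) : Type (max u v w) :=
  Quot (TripleRel (E := E) (Z₀ := Z₀) (A₀ := A₀))

variable {E S} in
/-- The class of a triple. -/
def Triple.cls {Z₀ A₀ : Loc S} (τ : Triple E Z₀ A₀) : LocExt E Z₀ A₀ := Quot.mk _ τ

variable {E} in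
/-- The realization on the localization: the class of a triple `(t, δ, s)` is realized by
`A₀ ⟶ Y ⟶ Z₀` with morphisms `Q(f) ∘ s` and `t ∘ Q(g)`, where `X ⟶ Y ⟶ Z` with morphisms
`f` and `g` realizes `δ`. -/
def LocRealizes (s : Realization E) {A B Z : Loc S} (x : A ⟶ B) (y : B ⟶ Z)
    (θ : LocExt E Z A) : Prop :=
  ∃ τ : Triple E Z A, τ.cls = θ ∧ ∃ (Y : C) (f : τ.X ⟶ Y) (g : Y ⟶ τ.Z), s f g τ.δ ∧
    SeqEquiv (B := (Q S).obj Y) (toLoc (S := S) (Y := (Q S).obj Y) (τ.s ≫ (proj S).map f))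
      (toLoc (S := S) (X := (Q S).obj Y) ((proj S).map g ≫ τ.t)) x y

/-- A biadditive functor on the localization whose values are the sets `LocExt E Z A`, with the
sum over a common denominator and with the functoriality given by completing squares. -/
structure LocalizedBifunctor [IsSumClosed S] [(closureS S).HasLeftCalculusOfFractions] where
  functor : (Loc S)ᵒᵖ ⥤ Loc S ⥤ AddCommGrpCat.{max u v w}
  /-- the identification of the values with the sets of classes of triples -/
  equiv : ∀ Z A : Loc S, LocExt E Z A ≃ Ext functor Z A
  biadditive : IsBiadditive functor
  add_eq : ∀ {Z₀ A₀ : Loc S} {Z X : C} (t : (proj S).obj Z ⟶ under Z₀) (ht : closureS S t)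
    (s : under A₀ ⟶ (proj S).obj X) (hs : closureS S s) (δ₁ δ₂ : Ext E Z X),
    equiv Z₀ A₀ (Triple.cls ⟨t, ht, δ₁, s, hs⟩) + equiv Z₀ A₀ (Triple.cls ⟨t, ht, δ₂, s, hs⟩) =
      equiv Z₀ A₀ (Triple.cls ⟨t, ht, δ₁ + δ₂, s, hs⟩)
  /-- if `α = Q(u)⁻¹ ∘ Q(a)` and `a' ∘ s = s' ∘ a`, then `α_* [t, δ, s] = [t, a'_* δ, s' ∘ u]` -/
  push_eq : ∀ {Z₀ A₀ A₁ D : Loc S} (α : A₀ ⟶ A₁) (a : under A₀ ⟶ under D)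
    (u : under A₁ ⟶ under D) (hu : closureS S u), α ≫ toLoc u = toLoc a →
    ∀ (τ : Triple E Z₀ A₀) {X' : C} (a' : τ.X ⟶ X') (s' : under D ⟶ (proj S).obj X')
      (hs' : closureS S s'), τ.s ≫ (proj S).map a' = a ≫ s' →
    push functor α (equiv Z₀ A₀ τ.cls) =
      equiv Z₀ A₁ (Triple.cls ⟨τ.t, τ.ht, push E a' τ.δ, u ≫ s',
        (closureS S).comp_mem _ _ hu hs'⟩)
  /-- if `γ = Q(c) ∘ Q(v)⁻¹` and `t ∘ c' = c ∘ t'`, then `γ^* [t, δ, s] = [v ∘ t', c'^* δ, s]` -/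
  pull_eq : ∀ {A₀ Z₀ Z₁ D : Loc S} (γ : Z₁ ⟶ Z₀) (c : under D ⟶ under Z₀)
    (v : under D ⟶ under Z₁) (hv : closureS S v), toLoc v ≫ γ = toLoc c →
    ∀ (τ : Triple E Z₀ A₀) {Z' : C} (c' : Z' ⟶ τ.Z) (t' : (proj S).obj Z' ⟶ under D)
      (ht' : closureS S t'), (proj S).map c' ≫ τ.t = t' ≫ c →
    pull functor γ (equiv Z₀ A₀ τ.cls) =
      equiv Z₁ A₀ (Triple.cls ⟨t' ≫ v, (closureS S).comp_mem _ _ ht' hv, pull E c' τ.δ,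
        τ.s, τ.hs⟩)

variable {E S} in
/-- The realization on the localization, transported to the bifunctor. -/
def LocalizedBifunctor.realization [IsSumClosed S] [(closureS S).HasLeftCalculusOfFractions]
    (F : LocalizedBifunctor E S) (s : Realization E) : Realization F.functor :=
  fun A _ Z x y θ => LocRealizes S s x y ((F.equiv Z A).symm θ)

/-! ### The conditions on `S` -/

variable {E}

/-- Morphisms in `closureS S` on the ends of two conflations, compatible with the extensions,
are completed by a morphism in `closureS S` in the middle. -/
def LiftsToMiddle (s : Realization E) : Prop :=
  ∀ ⦃A B Z A' B' Z' : C⦄ (x : A ⟶ B) (y : B ⟶ Z) (δ : Ext E Z A)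
    (x' : A' ⟶ B') (y' : B' ⟶ Z') (δ' : Ext E Z' A') (a : A ⟶ A') (c : Z ⟶ Z'),
    s x y δ → s x' y' δ' → push E a δ = pull E c δ' →
    closureS S ((proj S).map a) → closureS S ((proj S).map c) →
    ∃ b : (proj S).obj B ⟶ (proj S).obj B', closureS S b ∧
      (proj S).map x ≫ b = (proj S).map a ≫ (proj S).map x' ∧
      (proj S).map y ≫ (proj S).map c = b ≫ (proj S).map y'

/-- The morphisms `v ∘ p(x) ∘ u` with `x` an inflation and `u, v` in `closureS S`. -/
def barInf (s : Realization E) : MorphismProperty (IdealQuotient S) := fun X Y f =>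
  ∃ (A B : C) (u : X ⟶ (proj S).obj A) (x : A ⟶ B) (v : (proj S).obj B ⟶ Y),
    IsInflation s x ∧ closureS S u ∧ closureS S v ∧ u ≫ (proj S).map x ≫ v = f

/-- The morphisms `v ∘ p(y) ∘ u` with `y` a deflation and `u, v` in `closureS S`. -/
def barDef (s : Realization E) : MorphismProperty (IdealQuotient S) := fun X Y f =>
  ∃ (B Z : C) (u : X ⟶ (proj S).obj B) (y : B ⟶ Z) (v : (proj S).obj Z ⟶ Y),
    IsDeflation s y ∧ closureS S u ∧ closureS S v ∧ u ≫ (proj S).map y ≫ v = f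

/-- Morphisms killed by composition with an inflation or a deflation lie in the ideal. -/
structure KernelsAreNull (s : Realization E) : Prop where
  inflation : ∀ {X A B : C} (x : A ⟶ B) (f : X ⟶ A), IsInflation s x → f ≫ x = 0 →
    FactorsThroughNull S f
  deflation : ∀ {B Z X : C} (y : B ⟶ Z) (g : Z ⟶ X), IsDeflation s y → y ≫ g = 0 →
    FactorsThroughNull S g

/-- Morphisms into or out of a null object are killed by a morphism inverted by `Q`. -/
structure KillsNull : Prop where
  target : ∀ {A N : C} (f : A ⟶ N), IsNull S N →
    ∃ (A' : C) (s : A' ⟶ A), s ≫ f = 0 ∧ IsIso ((Q S).map s)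
  source : ∀ {N A : C} (f : N ⟶ A), IsNull S N →
    ∃ (A' : C) (s : A ⟶ A'), f ≫ s = 0 ∧ IsIso ((Q S).map s)

end Localization

end Extriangulated

open Extriangulated

universe v' u'

set_option linter.unusedSectionVars false

/-! Condition (ii) removes the ideal quotient from the problem. Morphisms of `C` that agree modulo
the ideal differ by a morphism through a null object, so they become equal in `C` itself after
composition with a morphism whose class lies in `closureS S`. Hence the class `preS S` of morphisms
of `C` with class in `closureS S` has both calculi of fractions, and `Q` is the localization of `C`
at it (`KillsNull.isLocalization`). Most of the work can then be done for an arbitrary additive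
localization `Q : C ⥤ L` at a class `W` with both calculi.

In that setting an extension of `L` is an extension of `C` together with isomorphisms `Q Z ≅ Z₀` and
`A₀ ≅ Q X`, up to expansion (`locBifunctor`), and a conflation of `L` is a sequence isomorphic to
the image of a conflation of `C` (`LocSeq`). The decisive point is that, by (MR3), an extension
killed by push-forward along `W` is killed by pull-back along `W`, and conversely
(`KilledSymm.of_lifts`). Exactness questions in `L` can therefore be cleared of denominators and
solved in `C` (`exactSeq_map`). The five lemma then makes realizations unique, the square axioms are
carried over from `C`, and (MR4) gives closure under composition. (MR1) serves to identify triples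
with fractions (`TripleRel.of_over`).

By (i), a morphism killed by an inflation vanishes in `L` once denominators are cleared, so
inflations become monomorphisms, and dually deflations become epimorphisms. If all morphisms are
admissible, kernels and cokernels are read off from a factorization `f = me`, and a monic deflation
or an epic inflation is invertible, so every mono and every epi is normal. -/

namespace Extriangulated

/-! ### Push-forward and pull-back of extensions -/

section Actions

variable {C : Type u} [Category.{v} C] [Preadditive C] {E : Cᵒᵖ ⥤ C ⥤ AddCommGrpCat.{w}}

@[simp] lemma push_id {Z A : C} (δ : Ext E Z A) : push E (𝟙 A) δ = δ := by simp [push]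

lemma push_comp {Z A A' A'' : C} (a : A ⟶ A') (b : A' ⟶ A'') (δ : Ext E Z A) :
    push E (a ≫ b) δ = push E b (push E a δ) := by simp [push]

@[simp] lemma pull_id {Z A : C} (δ : Ext E Z A) : pull E (𝟙 Z) δ = δ := by simp [pull]

lemma pull_comp {Z Z' Z'' A : C} (c : Z' ⟶ Z) (d : Z'' ⟶ Z') (δ : Ext E Z A) :
    pull E (d ≫ c) δ = pull E d (pull E c δ) := by simp [pull]

lemma push_pull {Z Z' A A' : C} (c : Z' ⟶ Z) (a : A ⟶ A') (δ : Ext E Z A) :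
    push E a (pull E c δ) = pull E c (push E a δ) :=
  (ConcreteCategory.congr_hom ((E.map c.op).naturality a) δ).symm

@[simp] lemma push_add {Z A A' : C} (a : A ⟶ A') (δ₁ δ₂ : Ext E Z A) :
    push E a (δ₁ + δ₂) = push E a δ₁ + push E a δ₂ := by simp [push]

@[simp] lemma push_neg {Z A A' : C} (a : A ⟶ A') (δ : Ext E Z A) :
    push E a (-δ) = -push E a δ := by simp [push]

@[simp] lemma push_sub {Z A A' : C} (a : A ⟶ A') (δ₁ δ₂ : Ext E Z A) :
    push E a (δ₁ - δ₂) = push E a δ₁ - push E a δ₂ := by simp [push]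

@[simp] lemma push_zero {Z A A' : C} (a : A ⟶ A') :
    push E a (0 : Ext E Z A) = 0 := by simp [push]

@[simp] lemma pull_add {Z Z' A : C} (c : Z' ⟶ Z) (δ₁ δ₂ : Ext E Z A) :
    pull E c (δ₁ + δ₂) = pull E c δ₁ + pull E c δ₂ := by simp [pull]

@[simp] lemma pull_neg {Z Z' A : C} (c : Z' ⟶ Z) (δ : Ext E Z A) :
    pull E c (-δ) = -pull E c δ := by simp [pull]

@[simp] lemma pull_zero {Z Z' A : C} (c : Z' ⟶ Z) :
    pull E c (0 : Ext E Z A) = 0 := by simp [pull]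

lemma IsBiadditive.add_push (h : IsBiadditive E) {Z A A' : C} (a b : A ⟶ A') (δ : Ext E Z A) :
    push E (a + b) δ = push E a δ + push E b δ := by
  have := h.right (op Z)
  simp [push, Functor.map_add]

lemma IsBiadditive.add_pull (h : IsBiadditive E) {Z Z' A : C} (c d : Z' ⟶ Z) (δ : Ext E Z A) :
    pull E (c + d) δ = pull E c δ + pull E d δ := by
  have := h.left
  simp [pull, Functor.map_add]

end Actions

/-! ### Fractions with strictly commuting triangles -/

section Roofs

variable {C : Type u} [Category.{v} C] {L : Type u'} [Category.{v'} L] (Q : C ⥤ L)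
  (W : MorphismProperty C) [Q.IsLocalization W]

/-- Every morphism of the localization is a right fraction. -/
lemma exists_right_denominator [W.HasRightCalculusOfFractions] {X Y : C}
    (φ : Q.obj X ⟶ Q.obj Y) :
    ∃ (X' : C) (q : X' ⟶ X) (f : X' ⟶ Y), W q ∧ Q.map q ≫ φ = Q.map f := by
  obtain ⟨ψ, hψ⟩ := Localization.exists_rightFraction Q W φ
  exact ⟨ψ.X', ψ.s, ψ.f, ψ.hs, by rw [hψ, MorphismProperty.RightFraction.map_s_comp_map]⟩

/-- Every morphism of the localization is a left fraction. -/
lemma exists_left_denominator [W.HasLeftCalculusOfFractions] {X Y : C}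
    (φ : Q.obj X ⟶ Q.obj Y) :
    ∃ (Y' : C) (p : Y ⟶ Y') (f : X ⟶ Y'), W p ∧ φ ≫ Q.map p = Q.map f := by
  obtain ⟨ψ, hψ⟩ := Localization.exists_leftFraction Q W φ
  exact ⟨ψ.Y', ψ.s, ψ.f, ψ.hs, by rw [hψ, MorphismProperty.LeftFraction.map_comp_map_s]⟩

/-- A right denominator of a morphism that makes a triangle commute strictly. -/
lemma exists_roof [W.HasRightCalculusOfFractions] {X Y D : C} (φ : Q.obj X ⟶ Q.obj Y)
    (c : X ⟶ D) (d : Y ⟶ D) (h : φ ≫ Q.map d = Q.map c) :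
    ∃ (X' : C) (q : X' ⟶ X) (f : X' ⟶ Y), W q ∧ Q.map q ≫ φ = Q.map f ∧ q ≫ c = f ≫ d := by
  obtain ⟨X', q, f, hq, hf⟩ := exists_right_denominator Q W φ
  obtain ⟨X'', r, hr, hr'⟩ := (MorphismProperty.map_eq_iff_precomp Q W (q ≫ c) (f ≫ d)).1
    (by simp [← h, ← hf])
  exact ⟨X'', r ≫ q, r ≫ f, W.comp_mem _ _ hr hq, by simp [hf], by simpa using hr'⟩

/-- A left denominator of a morphism that makes a triangle commute strictly. -/
lemma exists_coroof [W.HasLeftCalculusOfFractions] {X Y D : C} (φ : Q.obj X ⟶ Q.obj Y)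
    (a : D ⟶ X) (b : D ⟶ Y) (h : Q.map a ≫ φ = Q.map b) :
    ∃ (Y' : C) (p : Y ⟶ Y') (f : X ⟶ Y'), W p ∧ φ ≫ Q.map p = Q.map f ∧ b ≫ p = a ≫ f := by
  obtain ⟨Y', p, f, hp, hf⟩ := exists_left_denominator Q W φ
  obtain ⟨Y'', r, hr, hr'⟩ := (MorphismProperty.map_eq_iff_postcomp Q W (b ≫ p) (a ≫ f)).1
    (by simp [← h, ← hf])
  exact ⟨Y'', p ≫ r, f ≫ r, W.comp_mem _ _ hp hr, by simp [reassoc_of% hf], by simpa using hr'⟩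

end Roofs

/-! ### Extensions of the localization as classes of fractions -/

section Fractions

variable {C : Type u} [Category.{v} C] [Preadditive C] {L : Type u'} [Category.{v'} L]

/-- A fraction `Z₀ ≅ Q Z`, `δ ∈ E(Z, X)`, `A₀ ≅ Q X`. -/
structure Frac (Q : C ⥤ L) (E : Cᵒᵖ ⥤ C ⥤ AddCommGrpCat.{w}) (Z₀ A₀ : L) :
    Type (max u v' w) where
  Z : C
  X : C
  t : Q.obj Z ≅ Z₀
  δ : Ext E Z X
  s : A₀ ≅ Q.obj X

variable {Q : C ⥤ L} {E : Cᵒᵖ ⥤ C ⥤ AddCommGrpCat.{w}} (W : MorphismProperty C)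

/-- `τ'` is the image of `τ` under `γ` and `α`. -/
def Over {Z₀ Z₁ A₀ A₁ : L} (γ : Z₁ ⟶ Z₀) (α : A₀ ⟶ A₁) (τ : Frac Q E Z₀ A₀)
    (τ' : Frac Q E Z₁ A₁) : Prop :=
  ∃ (Z X : C) (v : Z ⟶ τ'.Z) (c : Z ⟶ τ.Z) (u : τ'.X ⟶ X) (a : τ.X ⟶ X), W v ∧ W u ∧
    Q.map v ≫ τ'.t.hom ≫ γ = Q.map c ≫ τ.t.hom ∧ τ.s.hom ≫ Q.map a = α ≫ τ'.s.hom ≫ Q.map u ∧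
    pull E v (push E u τ'.δ) = pull E c (push E a τ.δ)

variable {W}

lemma Over.of_eq [W.ContainsIdentities] {Z₀ Z₁ A₀ A₁ : L} {γ : Z₁ ⟶ Z₀} {α : A₀ ⟶ A₁}
    {τ : Frac Q E Z₀ A₀} {τ' : Frac Q E Z₁ A₁} (c : τ'.Z ⟶ τ.Z) (a : τ.X ⟶ τ'.X)
    (hc : τ'.t.hom ≫ γ = Q.map c ≫ τ.t.hom) (ha : τ.s.hom ≫ Q.map a = α ≫ τ'.s.hom)
    (hδ : τ'.δ = pull E c (push E a τ.δ)) : Over W γ α τ τ' :=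
  ⟨_, _, 𝟙 _, c, 𝟙 _, a, W.id_mem _, W.id_mem _, by simp [hc], by simp [ha], by simp [hδ]⟩

lemma Over.refl [W.ContainsIdentities] {Z₀ A₀ : L} (τ : Frac Q E Z₀ A₀) :
    Over W (𝟙 _) (𝟙 _) τ τ :=
  .of_eq (𝟙 _) (𝟙 _) (by simp) (by simp) (by simp)

variable [Q.IsLocalization W] [W.HasLeftCalculusOfFractions] [W.HasRightCalculusOfFractions]

/-- The comparison `Q Z₂ ⟶ Q Z₁` of the two left denominators is represented by a roof commuting
strictly with the numerators `c₁`, `c₂`, and dually on the right. Both extensions then expand to the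
same image of `τ.δ`. Symmetry of the expansion relation is a special case. -/
lemma Over.unique {Z₀ Z₁ A₀ A₁ : L} {γ : Z₁ ⟶ Z₀} {α : A₀ ⟶ A₁} {τ : Frac Q E Z₀ A₀}
    {τ' τ'' : Frac Q E Z₁ A₁} (h : Over W γ α τ τ') (h' : Over W γ α τ τ'') :
    Over W (𝟙 _) (𝟙 _) τ' τ'' := by
  obtain ⟨Z₁, X₁, v₁, c₁, u₁, a₁, hv₁, hu₁, hc₁, ha₁, hδ₁⟩ := h
  obtain ⟨Z₂, X₂, v₂, c₂, u₂, a₂, hv₂, hu₂, hc₂, ha₂, hδ₂⟩ := h'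
  have := Localization.inverts Q W _ hv₁
  have := Localization.inverts Q W _ hu₁
  obtain ⟨Z, q, f, hq, hf, e⟩ := exists_roof Q W
    (Q.map v₂ ≫ τ''.t.hom ≫ τ'.t.inv ≫ inv (Q.map v₁)) c₂ c₁ (by
      rw [← cancel_mono τ.t.hom]
      simp [← hc₁, ← hc₂])
  obtain ⟨X, p, g, hp, hg, e'⟩ := exists_coroof Q W
    (inv (Q.map u₁) ≫ τ'.s.inv ≫ τ''.s.hom ≫ Q.map u₂) a₁ a₂ (by
      rw [← cancel_epi τ.s.hom, reassoc_of% ha₁]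
      simp [ha₂])
  refine ⟨Z, X, q ≫ v₂, f ≫ v₁, u₂ ≫ p, u₁ ≫ g, W.comp_mem _ _ hq hv₂, W.comp_mem _ _ hu₂ hp,
    by simp [← hf], by simp [← hg], ?_⟩
  rw [push_comp, pull_comp, ← push_pull, hδ₂, push_pull, ← pull_comp, ← push_comp, e, e',
    push_comp, push_comp, pull_comp, pull_comp, ← push_pull, ← push_pull (c := v₁), hδ₁]

lemma Over.symm {Z₀ A₀ : L} {τ τ' : Frac Q E Z₀ A₀} (h : Over W (𝟙 _) (𝟙 _) τ τ') :
    Over W (𝟙 _) (𝟙 _) τ' τ :=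
  h.unique (Over.refl τ)

lemma Over.comp {Z₀ Z₁ Z₂ A₀ A₁ A₂ : L} {γ : Z₁ ⟶ Z₀} {α : A₀ ⟶ A₁} {γ' : Z₂ ⟶ Z₁}
    {α' : A₁ ⟶ A₂} {τ : Frac Q E Z₀ A₀} {τ' : Frac Q E Z₁ A₁} {τ'' : Frac Q E Z₂ A₂}
    (h : Over W γ α τ τ') (h' : Over W γ' α' τ' τ'') :
    Over W (γ' ≫ γ) (α ≫ α') τ τ'' := by
  obtain ⟨Z₁, X₁, v₁, c₁, u₁, a₁, hv₁, hu₁, hc₁, ha₁, hδ₁⟩ := h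
  obtain ⟨Z₂, X₂, v₂, c₂, u₂, a₂, hv₂, hu₂, hc₂, ha₂, hδ₂⟩ := h'
  have := Localization.inverts Q W _ hv₁
  have := Localization.inverts Q W _ hu₁
  obtain ⟨Z, q, f, hq, hf, e⟩ := exists_roof Q W (Q.map c₂ ≫ inv (Q.map v₁)) c₂ v₁ (by simp)
  obtain ⟨X, p, g, hp, hg, e'⟩ := exists_coroof Q W (inv (Q.map u₁) ≫ Q.map a₂) u₁ a₂ (by simp)
  refine ⟨Z, X, q ≫ v₂, f ≫ c₁, u₂ ≫ p, a₁ ≫ g, W.comp_mem _ _ hq hv₂, W.comp_mem _ _ hu₂ hp,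
    ?_, ?_, ?_⟩
  · simp [reassoc_of% hc₂, ← hc₁, ← hf]
  · simp [reassoc_of% ha₁, ← reassoc_of% ha₂, ← hg]
  · rw [push_comp, pull_comp, ← push_pull, hδ₂, push_pull, ← pull_comp, ← push_comp, e, e',
      push_comp, push_comp, pull_comp, pull_comp, ← push_pull, hδ₁]
    simp only [push_pull]

lemma Over.congr {Z₀ Z₁ A₀ A₁ : L} {γ : Z₁ ⟶ Z₀} {α : A₀ ⟶ A₁} {τ₁ τ₂ : Frac Q E Z₀ A₀}
    {τ₁' τ₂' : Frac Q E Z₁ A₁} (h : Over W γ α τ₁ τ₁') (h₁ : Over W (𝟙 _) (𝟙 _) τ₁ τ₂)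
    (h₂ : Over W (𝟙 _) (𝟙 _) τ₁' τ₂') : Over W γ α τ₂ τ₂' := by
  simpa using h₁.symm.comp (h.comp h₂)

variable (W) in
/-- The ends of an extension can be transported along morphisms of the localization, with
denominators in `W`. -/
lemma exists_ends {Z₀ Z₁ A₀ A₁ : L} (γ : Z₁ ⟶ Z₀) (α : A₀ ⟶ A₁) {Z X Z₂ X₂ : C}
    (t : Q.obj Z ≅ Z₀) (s : A₀ ≅ Q.obj X) (t₂ : Q.obj Z₂ ≅ Z₁) (s₂ : A₁ ≅ Q.obj X₂) :
    ∃ (Z' X' : C) (q : Z' ⟶ Z₂) (p : X₂ ⟶ X') (c : Z' ⟶ Z) (a : X ⟶ X'), W q ∧ W p ∧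
      Q.map q ≫ t₂.hom ≫ γ = Q.map c ≫ t.hom ∧ s.hom ≫ Q.map a = α ≫ s₂.hom ≫ Q.map p := by
  obtain ⟨Z', q, c, hq, hc⟩ := exists_right_denominator Q W (t₂.hom ≫ γ ≫ t.inv)
  obtain ⟨X', p, a, hp, ha⟩ := exists_left_denominator Q W (s.inv ≫ α ≫ s₂.hom)
  exact ⟨Z', X', q, p, c, a, hq, hp, by simp [← hc], by simp [← ha]⟩

variable (Q E W) in
/-- Fractions up to expansion. -/
def fracSetoid (Z₀ A₀ : L) : Setoid (Frac Q E Z₀ A₀) where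
  r := Over W (𝟙 _) (𝟙 _)
  iseqv := ⟨Over.refl, Over.symm, fun h h' => by simpa using h.comp h'⟩

variable (Q E W) in
/-- The extensions in the localization `Q`, as classes of fractions. -/
def LExt (Z₀ A₀ : L) : Type (max u v' w) := Quotient (fracSetoid Q E W Z₀ A₀)

variable (W) in
/-- The class of a fraction. -/
def LExt.mk {Z₀ A₀ : L} (τ : Frac Q E Z₀ A₀) : LExt Q E W Z₀ A₀ :=
  Quotient.mk (fracSetoid Q E W Z₀ A₀) τ

lemma LExt.mk_eq_iff {Z₀ A₀ : L} {τ τ' : Frac Q E Z₀ A₀} :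
    mk W τ = mk W τ' ↔ Over W (𝟙 _) (𝟙 _) τ τ' :=
  Quotient.eq (r := fracSetoid Q E W Z₀ A₀)

lemma LExt.mk_surjective {Z₀ A₀ : L} (θ : LExt Q E W Z₀ A₀) : ∃ τ, mk W τ = θ :=
  Quotient.exists_rep θ

variable (Q W) in
/-- The isomorphism of the localization given by a morphism of `W`. -/
noncomputable def wIso {X Y : C} (q : X ⟶ Y) (hq : W q) : Q.obj X ≅ Q.obj Y :=
  have := Localization.inverts Q W _ hq
  asIso (Q.map q)

@[simp] lemma wIso_hom {X Y : C} (q : X ⟶ Y) (hq : W q) : (wIso Q W q hq).hom = Q.map q := rfl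

/-- Expanding a fraction. -/
lemma LExt.mk_expand {Z₀ A₀ : L} {Z X Z' X' : C} (t : Q.obj Z ≅ Z₀) (δ : Ext E Z X)
    (s : A₀ ≅ Q.obj X) (t' : Q.obj Z' ≅ Z₀) (s' : A₀ ≅ Q.obj X') (q : Z' ⟶ Z) (p : X ⟶ X')
    (hq : t'.hom = Q.map q ≫ t.hom) (hp : s'.hom = s.hom ≫ Q.map p) :
    mk W ⟨Z, X, t, δ, s⟩ = mk W ⟨Z', X', t', pull E q (push E p δ), s'⟩ :=
  mk_eq_iff.2 (.of_eq q p (by simp [hq]) (by simp [hp]) rfl)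

/-- Expanding a fraction `(t, δ, s)` to a common denominator with a given class. -/
lemma LExt.exists_common {Z₀ A₀ : L} {Z X : C} (t : Q.obj Z ≅ Z₀) (s : A₀ ≅ Q.obj X)
    (θ : LExt Q E W Z₀ A₀) : ∃ (Z' X' : C) (q : Z' ⟶ Z) (p : X ⟶ X') (t' : Q.obj Z' ≅ Z₀)
      (δ : Ext E Z' X') (s' : A₀ ≅ Q.obj X'), W q ∧ W p ∧ t'.hom = Q.map q ≫ t.hom ∧
      s'.hom = s.hom ≫ Q.map p ∧ θ = mk W ⟨Z', X', t', δ, s'⟩ := by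
  obtain ⟨⟨Z₂, X₂, t₂, δ, s₂⟩, rfl⟩ := θ.mk_surjective
  obtain ⟨Z', X', q, p, c, a, hq, hp, hc, ha⟩ := exists_ends W (𝟙 Z₀) (𝟙 A₀) t₂ s₂ t s
  refine ⟨Z', X', q, p, wIso Q W q hq ≪≫ t, pull E c (push E a δ), s ≪≫ wIso Q W p hp, hq, hp,
    by simp, by simp, ?_⟩
  exact mk_expand _ _ _ _ _ _ _ (by simpa using hc) (by simpa using ha.symm)

/-- Two classes have a common denominator. -/
lemma LExt.exists_common₂ {Z₀ A₀ : L} (θ₁ θ₂ : LExt Q E W Z₀ A₀) :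
    ∃ (Z X : C) (t : Q.obj Z ≅ Z₀) (s : A₀ ≅ Q.obj X) (δ₁ δ₂ : Ext E Z X),
      θ₁ = mk W ⟨Z, X, t, δ₁, s⟩ ∧ θ₂ = mk W ⟨Z, X, t, δ₂, s⟩ := by
  obtain ⟨⟨Z, X, t, δ, s⟩, rfl⟩ := θ₁.mk_surjective
  obtain ⟨Z', X', q, p, t', δ', s', hq, hp, ht, hs, rfl⟩ := exists_common t s θ₂
  exact ⟨Z', X', t', s', _, δ', mk_expand _ _ _ _ _ q p ht hs, rfl⟩

/-- Three classes have a common denominator. -/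
lemma LExt.exists_common₃ {Z₀ A₀ : L} (θ₁ θ₂ θ₃ : LExt Q E W Z₀ A₀) :
    ∃ (Z X : C) (t : Q.obj Z ≅ Z₀) (s : A₀ ≅ Q.obj X) (δ₁ δ₂ δ₃ : Ext E Z X),
      θ₁ = mk W ⟨Z, X, t, δ₁, s⟩ ∧ θ₂ = mk W ⟨Z, X, t, δ₂, s⟩ ∧ θ₃ = mk W ⟨Z, X, t, δ₃, s⟩ := by
  obtain ⟨Z, X, t, s, δ₁, δ₂, rfl, rfl⟩ := exists_common₂ θ₁ θ₂
  obtain ⟨Z', X', q, p, t', δ', s', hq, hp, ht, hs, rfl⟩ := exists_common t s θ₃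
  exact ⟨Z', X', t', s', _, _, δ', mk_expand _ _ _ _ _ q p ht hs, mk_expand _ _ _ _ _ q p ht hs,
    rfl⟩

/-- Fractions over a common denominator are equal when they become so after an expansion. -/
lemma LExt.mk_eq_mk_iff {Z₀ A₀ : L} {Z X : C} {t : Q.obj Z ≅ Z₀} {s : A₀ ≅ Q.obj X}
    {δ₁ δ₂ : Ext E Z X} : mk W ⟨Z, X, t, δ₁, s⟩ = mk W ⟨Z, X, t, δ₂, s⟩ ↔
      ∃ (Z' X' : C) (q : Z' ⟶ Z) (p : X ⟶ X'), W q ∧ W p ∧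
        pull E q (push E p δ₁) = pull E q (push E p δ₂) := by
  constructor
  · intro h
    obtain ⟨Z', X', v, c, u, a, hv, hu, hc, ha, hδ⟩ := mk_eq_iff.1 h
    dsimp at v c u a hc ha hδ
    -- The fractions share `t` and `s`, so `v` and `c` have the same image under `Q`, as do `u` and
    -- `a`. Further morphisms of `W` equalize them.
    obtain ⟨Z'', r, hr, hr'⟩ := (MorphismProperty.map_eq_iff_precomp Q W v c).1
      (by rw [← cancel_mono t.hom]; simpa using hc)
    obtain ⟨X'', l, hl, hl'⟩ := (MorphismProperty.map_eq_iff_postcomp Q W u a).1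
      (by rw [← cancel_epi s.hom]; simpa using ha.symm)
    refine ⟨Z'', X'', r ≫ v, u ≫ l, W.comp_mem _ _ hr hv, W.comp_mem _ _ hu hl, Eq.symm ?_⟩
    rw [push_comp, pull_comp, ← push_pull (c := v), hδ, push_pull, ← push_comp, ← pull_comp, hr',
      hl']
  · rintro ⟨Z', X', q, p, hq, hp, h⟩
    rw [mk_expand (W := W) t δ₁ s (wIso Q W q hq ≪≫ t) (s ≪≫ wIso Q W p hp) q p (by simp) (by simp),
      mk_expand (W := W) t δ₂ s (wIso Q W q hq ≪≫ t) (s ≪≫ wIso Q W p hp) q p (by simp) (by simp),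
      h]

/-- The sum of extensions with equal classes. -/
lemma LExt.mk_add_congr {Z₀ A₀ : L} {Z X Z' X' : C} {t : Q.obj Z ≅ Z₀} {s : A₀ ≅ Q.obj X}
    {t' : Q.obj Z' ≅ Z₀} {s' : A₀ ≅ Q.obj X'} {δ₁ δ₂ : Ext E Z X} {δ₁' δ₂' : Ext E Z' X'}
    (h₁ : mk W ⟨Z, X, t, δ₁, s⟩ = mk W ⟨Z', X', t', δ₁', s'⟩)
    (h₂ : mk W ⟨Z, X, t, δ₂, s⟩ = mk W ⟨Z', X', t', δ₂', s'⟩) :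
    mk W ⟨Z, X, t, δ₁ + δ₂, s⟩ = mk W ⟨Z', X', t', δ₁' + δ₂', s'⟩ := by
  obtain ⟨Z₁, X₁, q, p, c, a, hq, hp, hc, ha⟩ := exists_ends W (𝟙 Z₀) (𝟙 A₀) t' s' t s
  have hc' : (wIso Q W q hq ≪≫ t).hom = Q.map c ≫ t'.hom := by simpa using hc
  have ha' : (s ≪≫ wIso Q W p hp).hom = s'.hom ≫ Q.map a := by simpa using ha.symm
  rw [mk_expand t _ s (wIso Q W q hq ≪≫ t) (s ≪≫ wIso Q W p hp) q p (by simp) (by simp),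
    mk_expand t' _ s' (wIso Q W q hq ≪≫ t) (s ≪≫ wIso Q W p hp) c a hc' ha'] at h₁ h₂ ⊢
  rw [mk_eq_mk_iff] at h₁ h₂ ⊢
  obtain ⟨Z₂, X₂, q₂, p₂, hq₂, hp₂, h₁⟩ := h₁
  obtain ⟨Z₃, X₃, q₃, p₃, hq₃, hp₃, h₂⟩ := h₂
  -- The two equalities hold after different expansions. Ore squares provide an expansion that
  -- refines both.
  obtain ⟨ψ, hψ⟩ := (MorphismProperty.LeftFraction.mk q₂ q₃ hq₃).exists_rightFraction
  obtain ⟨χ, hχ⟩ := (MorphismProperty.RightFraction.mk p₃ hp₃ p₂).exists_leftFraction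
  dsimp at hψ hχ
  refine ⟨_, _, ψ.s ≫ q₂, p₂ ≫ χ.s, W.comp_mem _ _ ψ.hs hq₂, W.comp_mem _ _ hp₂ χ.hs, ?_⟩
  simp only [push_add, pull_add]
  congr 1
  · rw [push_comp, pull_comp, ← push_pull (c := q₂), h₁]
    simp only [push_comp, pull_comp, push_pull]
  · rw [hψ, hχ, push_comp, pull_comp, ← push_pull (c := q₃), h₂]
    simp only [push_comp, pull_comp, push_pull]

end Fractions

/-! ### The biadditive bifunctor on the localization -/

section LocalizedExtensions

variable {C : Type u} [Category.{v} C] [Preadditive C] {L : Type u'} [Category.{v'} L]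
  {Q : C ⥤ L} {E : Cᵒᵖ ⥤ C ⥤ AddCommGrpCat.{w}} {W : MorphismProperty C}
  [Q.IsLocalization W] [W.HasLeftCalculusOfFractions] [W.HasRightCalculusOfFractions]

namespace LExt

/-- The sum over a common denominator. -/
noncomputable instance {Z₀ A₀ : L} : Add (LExt Q E W Z₀ A₀) where
  add θ₁ θ₂ :=
    let h := exists_common₂ θ₁ θ₂
    mk W ⟨_, _, h.choose_spec.choose_spec.choose,
      h.choose_spec.choose_spec.choose_spec.choose_spec.choose +
        h.choose_spec.choose_spec.choose_spec.choose_spec.choose_spec.choose,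
      h.choose_spec.choose_spec.choose_spec.choose⟩

/-- The sum is defined through a chosen common denominator; `mk_add_congr` makes that choice
irrelevant. -/
lemma mk_add_mk {Z₀ A₀ : L} {Z X : C} (t : Q.obj Z ≅ Z₀) (s : A₀ ≅ Q.obj X)
    (δ₁ δ₂ : Ext E Z X) :
    mk W ⟨Z, X, t, δ₁, s⟩ + mk W ⟨Z, X, t, δ₂, s⟩ = mk W ⟨Z, X, t, δ₁ + δ₂, s⟩ := by
  have h := (exists_common₂ (mk W ⟨Z, X, t, δ₁, s⟩)
    (mk W ⟨Z, X, t, δ₂, s⟩)).choose_spec.choose_spec.choose_spec.choose_spec.choose_spec.choose_spec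
  exact mk_add_congr h.1.symm h.2.symm

/-- The class of the zero extension. -/
noncomputable instance {Z₀ A₀ : L} : Zero (LExt Q E W Z₀ A₀) where
  zero :=
    have := Localization.essSurj Q W
    mk W ⟨_, _, Q.objObjPreimageIso Z₀, 0, (Q.objObjPreimageIso A₀).symm⟩

lemma mk_zero {Z₀ A₀ : L} {Z X : C} (t : Q.obj Z ≅ Z₀) (s : A₀ ≅ Q.obj X) :
    mk W ⟨Z, X, t, (0 : Ext E Z X), s⟩ = 0 := by
  have := Localization.essSurj Q W
  obtain ⟨Z', X', q, p, c, a, hq, hp, hc, ha⟩ := exists_ends W (𝟙 Z₀) (𝟙 A₀)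
    (Q.objObjPreimageIso Z₀) (Q.objObjPreimageIso A₀).symm t s
  rw [mk_expand t _ s (wIso Q W q hq ≪≫ t) (s ≪≫ wIso Q W p hp) q p (by simp) (by simp)]
  refine Eq.trans ?_ (mk_expand (Q.objObjPreimageIso Z₀) _ (Q.objObjPreimageIso A₀).symm
    (wIso Q W q hq ≪≫ t) (s ≪≫ wIso Q W p hp) c a
      (by simpa using hc) (by simpa using ha.symm)).symm
  simp

/-- The opposite of a class. -/
noncomputable instance {Z₀ A₀ : L} : Neg (LExt Q E W Z₀ A₀) where
  neg := Quotient.map (fun τ => ⟨τ.Z, τ.X, τ.t, -τ.δ, τ.s⟩) (by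
    rintro τ τ' ⟨Z, X, v, c, u, a, hv, hu, hc, ha, hδ⟩
    exact ⟨Z, X, v, c, u, a, hv, hu, hc, ha, by simp [hδ]⟩)

lemma neg_mk {Z₀ A₀ : L} {Z X : C} (t : Q.obj Z ≅ Z₀) (s : A₀ ≅ Q.obj X) (δ : Ext E Z X) :
    -mk W ⟨Z, X, t, δ, s⟩ = mk W ⟨Z, X, t, -δ, s⟩ := rfl

noncomputable instance {Z₀ A₀ : L} : AddCommGroup (LExt Q E W Z₀ A₀) where
  add_assoc θ₁ θ₂ θ₃ := by
    obtain ⟨Z, X, t, s, δ₁, δ₂, δ₃, rfl, rfl, rfl⟩ := exists_common₃ θ₁ θ₂ θ₃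
    simp only [mk_add_mk, add_assoc]
  zero_add θ := by
    obtain ⟨⟨Z, X, t, δ, s⟩, rfl⟩ := θ.mk_surjective
    rw [← mk_zero t s, mk_add_mk, zero_add]
  add_zero θ := by
    obtain ⟨⟨Z, X, t, δ, s⟩, rfl⟩ := θ.mk_surjective
    rw [← mk_zero t s, mk_add_mk, add_zero]
  add_comm θ₁ θ₂ := by
    obtain ⟨Z, X, t, s, δ₁, δ₂, rfl, rfl⟩ := exists_common₂ θ₁ θ₂
    simp only [mk_add_mk, add_comm]
  neg_add_cancel θ := by
    obtain ⟨⟨Z, X, t, δ, s⟩, rfl⟩ := θ.mk_surjective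
    rw [neg_mk, mk_add_mk, neg_add_cancel, mk_zero]
  nsmul := nsmulRec
  zsmul := zsmulRec

/-- Two extensions with given ends can be transported over a common denominator. -/
lemma exists_map (W : MorphismProperty C) [Q.IsLocalization W] [W.HasLeftCalculusOfFractions]
    [W.HasRightCalculusOfFractions] {Z₀ Z₁ A₀ A₁ : L} (γ : Z₁ ⟶ Z₀) (α : A₀ ⟶ A₁) {Z X : C}
    (t : Q.obj Z ≅ Z₀) (s : A₀ ≅ Q.obj X) : ∃ (Z' X' : C) (t' : Q.obj Z' ≅ Z₁) (s' : A₁ ≅ Q.obj X') (c : Z' ⟶ Z)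
      (a : X ⟶ X'), t'.hom ≫ γ = Q.map c ≫ t.hom ∧ s.hom ≫ Q.map a = α ≫ s'.hom := by
  have := Localization.essSurj Q W
  obtain ⟨Z', X', q, p, c, a, hq, hp, hc, ha⟩ := exists_ends W γ α t s
    (Q.objObjPreimageIso Z₁) (Q.objObjPreimageIso A₁).symm
  exact ⟨Z', X', wIso Q W q hq ≪≫ Q.objObjPreimageIso Z₁,
    (Q.objObjPreimageIso A₁).symm ≪≫ wIso Q W p hp, c, a, by simpa using hc, by simpa using ha⟩

lemma exists_over {Z₀ Z₁ A₀ A₁ : L} (γ : Z₁ ⟶ Z₀) (α : A₀ ⟶ A₁) (τ : Frac Q E Z₀ A₀) :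
    ∃ τ', Over W γ α τ τ' := by
  obtain ⟨Z', X', t', s', c, a, hc, ha⟩ := exists_map W γ α τ.t τ.s
  exact ⟨⟨Z', X', t', pull E c (push E a τ.δ), s'⟩, .of_eq c a hc ha rfl⟩

variable (E W) in
/-- The action of morphisms of the localization on both ends. -/
noncomputable def mapFun {Z₀ Z₁ A₀ A₁ : L} (γ : Z₁ ⟶ Z₀) (α : A₀ ⟶ A₁) :
    LExt Q E W Z₀ A₀ → LExt Q E W Z₁ A₁ :=
  Quotient.lift (fun τ => mk W (exists_over (W := W) γ α τ).choose) (fun τ τ' h =>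
    mk_eq_iff.2 (((exists_over γ α τ).choose_spec.congr h (.refl _)).unique
      (exists_over γ α τ').choose_spec))

/-- `mapFun` picks some image of a representative. Images are unique up to expansion, so any other
image computes it too. -/
lemma mapFun_mk_eq_iff {Z₀ Z₁ A₀ A₁ : L} {γ : Z₁ ⟶ Z₀} {α : A₀ ⟶ A₁} {τ : Frac Q E Z₀ A₀}
    {τ' : Frac Q E Z₁ A₁} : mapFun E W γ α (mk W τ) = mk W τ' ↔ Over W γ α τ τ' := by
  refine Iff.trans mk_eq_iff ⟨fun h => ?_, fun h => ?_⟩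
  · exact (exists_over γ α τ).choose_spec.congr (.refl _) h
  · exact (exists_over γ α τ).choose_spec.unique h

lemma mapFun_mk {Z₀ Z₁ A₀ A₁ : L} {γ : Z₁ ⟶ Z₀} {α : A₀ ⟶ A₁} {Z X Z' X' : C}
    {t : Q.obj Z ≅ Z₀} {s : A₀ ≅ Q.obj X} {t' : Q.obj Z' ≅ Z₁} {s' : A₁ ≅ Q.obj X'}
    {c : Z' ⟶ Z} {a : X ⟶ X'} (hc : t'.hom ≫ γ = Q.map c ≫ t.hom)
    (ha : s.hom ≫ Q.map a = α ≫ s'.hom) (δ : Ext E Z X) :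
    mapFun E W γ α (mk W ⟨Z, X, t, δ, s⟩) =
      mk W ⟨Z', X', t', pull E c (push E a δ), s'⟩ :=
  mapFun_mk_eq_iff.2 (.of_eq c a hc ha rfl)

lemma mapFun_add {Z₀ Z₁ A₀ A₁ : L} (γ : Z₁ ⟶ Z₀) (α : A₀ ⟶ A₁) (θ₁ θ₂ : LExt Q E W Z₀ A₀) :
    mapFun E W γ α (θ₁ + θ₂) = mapFun E W γ α θ₁ + mapFun E W γ α θ₂ := by
  obtain ⟨Z, X, t, s, δ₁, δ₂, rfl, rfl⟩ := exists_common₂ θ₁ θ₂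
  obtain ⟨Z', X', t', s', c, a, hc, ha⟩ := exists_map W γ α t s
  simp only [mk_add_mk, mapFun_mk hc ha, push_add, pull_add]

lemma mapFun_id {Z₀ A₀ : L} (θ : LExt Q E W Z₀ A₀) : mapFun E W (𝟙 _) (𝟙 _) θ = θ := by
  obtain ⟨τ, rfl⟩ := θ.mk_surjective
  exact mapFun_mk_eq_iff.2 (.refl τ)

lemma mapFun_comp {Z₀ Z₁ Z₂ A₀ A₁ A₂ : L} (γ : Z₁ ⟶ Z₀) (α : A₀ ⟶ A₁) (γ' : Z₂ ⟶ Z₁)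
    (α' : A₁ ⟶ A₂) (θ : LExt Q E W Z₀ A₀) :
    mapFun E W (γ' ≫ γ) (α ≫ α') θ = mapFun E W γ' α' (mapFun E W γ α θ) := by
  obtain ⟨τ, rfl⟩ := θ.mk_surjective
  obtain ⟨τ', hτ'⟩ := exists_over (W := W) γ α τ
  obtain ⟨τ'', hτ''⟩ := exists_over (W := W) γ' α' τ'
  rw [mapFun_mk_eq_iff.2 hτ', mapFun_mk_eq_iff.2 hτ'', mapFun_mk_eq_iff.2 (hτ'.comp hτ'')]

variable (E W) in
/-- The action of morphisms of the localization on both ends, as a homomorphism. -/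
noncomputable def map {Z₀ Z₁ A₀ A₁ : L} (γ : Z₁ ⟶ Z₀) (α : A₀ ⟶ A₁) :
    LExt Q E W Z₀ A₀ →+ LExt Q E W Z₁ A₁ :=
  AddMonoidHom.mk' (mapFun E W γ α) (mapFun_add γ α)

end LExt

open LExt

variable (Q E W) in
/-- The bifunctor of extensions in the localization. -/
noncomputable def locBifunctor : Lᵒᵖ ⥤ L ⥤ AddCommGrpCat.{max u v' w} where
  obj Z :=
    { obj A := AddCommGrpCat.of (LExt Q E W Z.unop A)
      map α := AddCommGrpCat.ofHom (LExt.map E W (𝟙 _) α)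
      map_id A := by ext θ; exact mapFun_id θ
      map_comp α α' := by
        ext θ
        simpa using! mapFun_comp (𝟙 _) α (𝟙 _) α' θ }
  map γ :=
    { app A := AddCommGrpCat.ofHom (LExt.map E W γ.unop (𝟙 _))
      naturality A A' α := by
        ext θ
        -- Both composites of the naturality square are the joint action of `γ` and `α`.
        have h₁ := mapFun_comp (𝟙 _) α γ.unop (𝟙 _) θ
        have h₂ := mapFun_comp γ.unop (𝟙 _) (𝟙 _) α θ
        simp only [Category.id_comp, Category.comp_id] at h₁ h₂
        exact h₁.symm.trans h₂ }
  map_id Z := by ext A θ; exact mapFun_id θ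
  map_comp γ γ' := by
    ext A θ
    simpa using! mapFun_comp γ.unop (𝟙 A) γ'.unop (𝟙 A) θ

/-- The class of a fraction, as an element of the bifunctor. -/
noncomputable def lmk {Z₀ A₀ : L} (τ : Frac Q E Z₀ A₀) : Ext (locBifunctor Q E W) Z₀ A₀ :=
  LExt.mk W τ

lemma push_lmk {Z₀ A₀ A₁ : L} {α : A₀ ⟶ A₁} {Z X X' : C}
    {t : Q.obj Z ≅ Z₀} {s : A₀ ≅ Q.obj X} {s' : A₁ ≅ Q.obj X'} {a : X ⟶ X'}
    (ha : s.hom ≫ Q.map a = α ≫ s'.hom) (δ : Ext E Z X) :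
    push (locBifunctor Q E W) α (lmk ⟨Z, X, t, δ, s⟩) = lmk ⟨Z, X', t, push E a δ, s'⟩ := by
  refine (mapFun_mk (c := 𝟙 Z) (t' := t) (by simp) ha δ).trans ?_
  rw [pull_id]; rfl

lemma pull_lmk {Z₀ Z₁ A₀ : L} {γ : Z₁ ⟶ Z₀} {Z X Z' : C}
    {t : Q.obj Z ≅ Z₀} {s : A₀ ≅ Q.obj X} {t' : Q.obj Z' ≅ Z₁} {c : Z' ⟶ Z}
    (hc : t'.hom ≫ γ = Q.map c ≫ t.hom) (δ : Ext E Z X) :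
    pull (locBifunctor Q E W) γ (lmk ⟨Z, X, t, δ, s⟩) = lmk ⟨Z', X, t', pull E c δ, s⟩ := by
  refine (mapFun_mk (a := 𝟙 X) (s' := s) hc (by simp) δ).trans ?_
  rw [push_id]; rfl

lemma lmk_surjective {Z₀ A₀ : L} (θ : Ext (locBifunctor Q E W) Z₀ A₀) : ∃ τ, lmk τ = θ :=
  LExt.mk_surjective θ

/-- Every class is given by a fraction with denominators in `W`. -/
lemma exists_lmk {Z₀ A₀ : L} {Z X : C} (t : Q.obj Z ≅ Z₀) (s : A₀ ≅ Q.obj X)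
    (θ : Ext (locBifunctor Q E W) Z₀ A₀) :
    ∃ (Z' X' : C) (q : Z' ⟶ Z) (p : X ⟶ X') (hq : W q) (hp : W p) (δ : Ext E Z' X'),
      θ = lmk ⟨Z', X', wIso Q W q hq ≪≫ t, δ, s ≪≫ wIso Q W p hp⟩ := by
  obtain ⟨Z', X', q, p, t', δ, s', hq, hp, ht, hs, rfl⟩ := LExt.exists_common t s θ
  have ht' : t' = wIso Q W q hq ≪≫ t := by ext; simp [ht]
  have hs' : s' = s ≪≫ wIso Q W p hp := by ext; simp [hs]
  subst ht' hs'
  exact ⟨Z', X', q, p, hq, hp, δ, rfl⟩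

variable (Q W) in
/-- The class in the localization of an extension. -/
noncomputable def ext {Z A : C} (δ : Ext E Z A) :
    Ext (locBifunctor Q E W) (Q.obj Z) (Q.obj A) :=
  lmk ⟨Z, A, Iso.refl _, δ, Iso.refl _⟩

lemma push_ext {Z A A' : C} (a : A ⟶ A') (δ : Ext E Z A) :
    push (locBifunctor Q E W) (Q.map a) (ext Q W δ) = ext Q W (push E a δ) :=
  push_lmk (by simp) δ

lemma pull_ext {Z Z' A : C} (c : Z' ⟶ Z) (δ : Ext E Z A) :
    pull (locBifunctor Q E W) (Q.map c) (ext Q W δ) = ext Q W (pull E c δ) :=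
  pull_lmk (by simp) δ

lemma push_lmk_hom {Z₀ A₀ : L} (τ : Frac Q E Z₀ A₀) :
    push (locBifunctor Q E W) τ.s.hom (lmk τ) = pull _ τ.t.inv (ext Q W τ.δ) := by
  rw [ext, push_lmk (a := 𝟙 _) (s' := Iso.refl _) (by simp),
    pull_lmk (t' := τ.t) (c := 𝟙 _) (by simp)]
  simp

lemma ext_eq_iff {Z A : C} (δ₁ δ₂ : Ext E Z A) : ext Q W δ₁ = ext Q W δ₂ ↔
    ∃ (Z' A' : C) (q : Z' ⟶ Z) (p : A ⟶ A'), W q ∧ W p ∧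
      pull E q (push E p δ₁) = pull E q (push E p δ₂) :=
  mk_eq_mk_iff

lemma ext_zero {Z A : C} : ext Q W (0 : Ext E Z A) = 0 := LExt.mk_zero _ _

/-- Two morphisms of `L` can be written with a common denominator; the sum of their numerators then
represents their sum, and biadditivity of `E` applies. -/
lemma locBifunctor_biadditive [Preadditive L] [Q.Additive] (hE : IsBiadditive E) :
    IsBiadditive (locBifunctor Q E W) where
  left := ⟨fun {Z₀ Z₁ γ₁ γ₂} => by
    ext A θ
    obtain ⟨⟨Z, X, t, δ, s⟩, rfl⟩ := LExt.mk_surjective θ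
    have := Localization.essSurj Q W
    obtain ⟨Z', q, c₁, hq, hc₁⟩ := exists_right_denominator Q W
      ((Q.objObjPreimageIso Z₁.unop).hom ≫ γ₁.unop ≫ t.inv)
    obtain ⟨Z'', r, c₂, hr, hc₂⟩ := exists_right_denominator Q W
      (Q.map q ≫ (Q.objObjPreimageIso Z₁.unop).hom ≫ γ₂.unop ≫ t.inv)
    let t' := wIso Q W _ (W.comp_mem _ _ hr hq) ≪≫ Q.objObjPreimageIso Z₁.unop
    have h₁ : t'.hom ≫ γ₁.unop = Q.map (r ≫ c₁) ≫ t.hom := by simp [t', ← hc₁]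
    have h₂ : t'.hom ≫ γ₂.unop = Q.map c₂ ≫ t.hom := by simp [t', ← hc₂]
    have h₃ : t'.hom ≫ (γ₁ + γ₂).unop = Q.map (r ≫ c₁ + c₂) ≫ t.hom := by
      simp [Q.map_add, h₁, h₂]
    refine (mapFun_mk (a := 𝟙 X) (s' := s) h₃ (by simp) δ).trans (Eq.trans ?_ (congrArg₂ (· + ·)
      (mapFun_mk (a := 𝟙 X) (s' := s) h₁ (by simp) δ)
      (mapFun_mk (a := 𝟙 X) (s' := s) h₂ (by simp) δ)).symm)
    rw [mk_add_mk, hE.add_pull]⟩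
  right Z₀ := ⟨fun {A₀ A₁ α₁ α₂} => by
    ext θ
    obtain ⟨⟨Z, X, t, δ, s⟩, rfl⟩ := LExt.mk_surjective θ
    have := Localization.essSurj Q W
    obtain ⟨X', p, a₁, hp, ha₁⟩ := exists_left_denominator Q W
      (s.inv ≫ α₁ ≫ (Q.objObjPreimageIso A₁).inv)
    obtain ⟨X'', r, a₂, hr, ha₂⟩ := exists_left_denominator Q W
      ((s.inv ≫ α₂ ≫ (Q.objObjPreimageIso A₁).inv) ≫ Q.map p)
    let s' := (Q.objObjPreimageIso A₁).symm ≪≫ wIso Q W _ (W.comp_mem _ _ hp hr)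
    have h₁ : s.hom ≫ Q.map (a₁ ≫ r) = α₁ ≫ s'.hom := by simp [s', ← reassoc_of% ha₁]
    have h₂ : s.hom ≫ Q.map a₂ = α₂ ≫ s'.hom := by simp [s', ← ha₂]
    have h₃ : s.hom ≫ Q.map (a₁ ≫ r + a₂) = (α₁ + α₂) ≫ s'.hom := by
      rw [Q.map_add, Preadditive.comp_add, h₁, h₂, Preadditive.add_comp]
    refine (mapFun_mk (c := 𝟙 Z) (t' := t) (by simp) h₃ δ).trans (Eq.trans ?_ (congrArg₂ (· + ·)
      (mapFun_mk (c := 𝟙 Z) (t' := t) (by simp) h₁ δ)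
      (mapFun_mk (c := 𝟙 Z) (t' := t) (by simp) h₂ δ)).symm)
    rw [mk_add_mk, hE.add_push, pull_add]⟩

end LocalizedExtensions

/-! ### Exact sequences of an extension and the five lemma -/

section ExactSequences

variable {C : Type u} [Category.{v} C] [Preadditive C] {E : Cᵒᵖ ⥤ C ⥤ AddCommGrpCat.{w}}

/-- The two long exact sequences of an extension. -/
structure ExactSeq {A B Z : C} (x : A ⟶ B) (y : B ⟶ Z) (δ : Ext E Z A) : Prop where
  left : ∀ X : C, Function.Exact (fun h : X ⟶ A => h ≫ x) (fun g : X ⟶ B => g ≫ y) ∧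
    Function.Exact (fun g : X ⟶ B => g ≫ y) (fun f : X ⟶ Z => pull E f δ)
  right : ∀ X : C, Function.Exact (fun h : Z ⟶ X => y ≫ h) (fun g : B ⟶ X => x ≫ g) ∧
    Function.Exact (fun g : B ⟶ X => x ≫ g) (fun f : A ⟶ X => push E f δ)

lemma IsWeaklyExtriangulated.exactSeq [HasZeroObject C] [HasBinaryBiproducts C]
    {s : Realization E} (hC : IsWeaklyExtriangulated E s) {A B Z : C} {x : A ⟶ B} {y : B ⟶ Z}
    {δ : Ext E Z A} (h : s x y δ) : ExactSeq x y δ :=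
  ⟨hC.exact_comp_left h, hC.exact_comp_right h⟩

namespace ExactSeq

variable {A B Z : C} {x : A ⟶ B} {y : B ⟶ Z} {δ : Ext E Z A}

lemma zero (h : ExactSeq x y δ) : x ≫ y = 0 :=
  ((h.left A).1 x).2 ⟨𝟙 A, by simp⟩

lemma pull_eq_zero (h : ExactSeq x y δ) : pull E y δ = 0 :=
  ((h.left B).2 y).2 ⟨𝟙 B, by simp⟩

lemma push_eq_zero (h : ExactSeq x y δ) : push E x δ = 0 :=
  ((h.right B).2 x).2 ⟨𝟙 B, by simp⟩

lemma exists_lift (h : ExactSeq x y δ) {X : C} (g : X ⟶ B) (hg : g ≫ y = 0) :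
    ∃ k : X ⟶ A, k ≫ x = g :=
  ((h.left X).1 g).1 hg

lemma exists_desc (h : ExactSeq x y δ) {X : C} (g : B ⟶ X) (hg : x ≫ g = 0) :
    ∃ k : Z ⟶ X, y ≫ k = g :=
  ((h.right X).1 g).1 hg

lemma exists_lift_deflation (h : ExactSeq x y δ) {X : C} (g : X ⟶ Z) (hg : pull E g δ = 0) :
    ∃ k : X ⟶ B, k ≫ y = g :=
  ((h.left X).2 g).1 hg

lemma exists_extend_inflation (h : ExactSeq x y δ) {X : C} (g : A ⟶ X) (hg : push E g δ = 0) :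
    ∃ k : B ⟶ X, x ≫ k = g :=
  ((h.right X).2 g).1 hg

lemma mk' (zero : x ≫ y = 0) (hpull : pull E y δ = 0) (hpush : push E x δ = 0)
    (lift : ∀ {X : C} (g : X ⟶ B), g ≫ y = 0 → ∃ k : X ⟶ A, k ≫ x = g)
    (lift' : ∀ {X : C} (g : X ⟶ Z), pull E g δ = 0 → ∃ k : X ⟶ B, k ≫ y = g)
    (desc : ∀ {X : C} (g : B ⟶ X), x ≫ g = 0 → ∃ k : Z ⟶ X, y ≫ k = g)
    (desc' : ∀ {X : C} (g : A ⟶ X), push E g δ = 0 → ∃ k : B ⟶ X, x ≫ k = g) :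
    ExactSeq x y δ where
  left X := by
    refine ⟨fun g => ⟨fun hg => lift g hg, ?_⟩, fun g => ⟨fun hg => lift' g hg, ?_⟩⟩
    · rintro ⟨k, rfl⟩
      simp [zero]
    · rintro ⟨k, rfl⟩
      simp only [pull_comp, hpull, pull_zero]
  right X := by
    refine ⟨fun g => ⟨fun hg => desc g hg, ?_⟩, fun g => ⟨fun hg => desc' g hg, ?_⟩⟩
    · rintro ⟨k, rfl⟩
      simp [reassoc_of% zero]
    · rintro ⟨k, rfl⟩
      simp only [push_comp, hpush, push_zero]

/-- The five lemma for a morphism of extensions. -/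
lemma isIso_middle (h : ExactSeq x y δ) {A' B' Z' : C} {x' : A' ⟶ B'} {y' : B' ⟶ Z'}
    {δ' : Ext E Z' A'} (h' : ExactSeq x' y' δ') (a : A ⟶ A') (b : B ⟶ B') (c : Z ⟶ Z') [IsIso a]
    [IsIso c] (hx : x ≫ b = a ≫ x') (hy : b ≫ y' = y ≫ c) (hδ : push E a δ = pull E c δ') :
    IsIso b := by
  -- Lift `y'` through `y` up to `c`, then correct the error, which `y'` kills, by a morphism
  -- through `x'`. The inverse on the other side is dual. Two one-sided inverses are needed because
  -- neither `x` nor `y` is known to be cancellable.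
  have e₁ : ∃ r : B' ⟶ B, r ≫ b = 𝟙 B' := by
    obtain ⟨k, hk⟩ := h.exists_lift_deflation (y' ≫ inv c) (by
      rw [← push_id (pull E _ δ), ← IsIso.hom_inv_id a, push_comp, push_pull, hδ, ← pull_comp]
      simp [h'.pull_eq_zero])
    obtain ⟨m, hm⟩ := h'.exists_lift (𝟙 _ - k ≫ b) (by
      simp [hy, reassoc_of% hk])
    exact ⟨k + m ≫ inv a ≫ x, by simp [hx, hm]⟩
  have e₂ : ∃ r : B' ⟶ B, b ≫ r = 𝟙 B := by
    obtain ⟨k, hk⟩ := h'.exists_extend_inflation (inv a ≫ x) (by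
      rw [← pull_id (push E _ δ'), ← IsIso.inv_hom_id c, pull_comp, ← push_pull, ← hδ, ← push_comp]
      simp [h.push_eq_zero])
    obtain ⟨m, hm⟩ := h.exists_desc (𝟙 _ - b ≫ k) (by
      simp [reassoc_of% hx, hk])
    exact ⟨k + y' ≫ inv c ≫ m, by simp [reassoc_of% hy, hm]⟩
  obtain ⟨r, hr⟩ := e₁
  obtain ⟨r', hr'⟩ := e₂
  have : r = r' := by rw [← Category.comp_id r, ← hr', reassoc_of% hr]
  exact ⟨r, this ▸ hr', hr⟩

end ExactSeq

lemma push_hom_injective {Z A A' : C} (e : A ≅ A') :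
    Function.Injective (push E e.hom : Ext E Z A → Ext E Z A') := fun δ₁ δ₂ h => by
  have := congrArg (push E e.inv) h
  simpa only [← push_comp, Iso.hom_inv_id, push_id] using this

lemma pull_hom_injective {Z Z' A : C} (e : Z' ≅ Z) :
    Function.Injective (pull E e.hom : Ext E Z A → Ext E Z' A) := fun δ₁ δ₂ h => by
  have := congrArg (pull E e.inv) h
  simpa only [← pull_comp, Iso.inv_hom_id, pull_id] using this

/-- A morphism of extensions is induced by a morphism of the realizing sequences. -/
lemma IsWeaklyExtriangulated.exists_middle [HasZeroObject C] [HasBinaryBiproducts C]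
    {s : Realization E} (hC : IsWeaklyExtriangulated E s) {A B Z A' B' Z' : C} {x : A ⟶ B}
    {y : B ⟶ Z} {δ : Ext E Z A} {x' : A' ⟶ B'} {y' : B' ⟶ Z'} {δ' : Ext E Z' A'}
    (h : s x y δ) (h' : s x' y' δ') (a : A ⟶ A') (c : Z ⟶ Z') (hδ : push E a δ = pull E c δ') :
    ∃ b : B ⟶ B', x ≫ b = a ≫ x' ∧ b ≫ y' = y ≫ c := by
  -- The morphism factors through a realization of `push E a δ = pull E c δ'`, changing one end at a
  -- time.
  obtain ⟨M, i, j, hM⟩ := hC.assignment.exists_seq (push E a δ)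
  obtain ⟨b₁, h₁, h₁', -⟩ := hC.push_square a h hM
  obtain ⟨b₂, h₂, h₂', -⟩ := hC.pull_square c h' (hδ ▸ hM)
  exact ⟨b₁ ≫ b₂, by simp [reassoc_of% h₁, h₂], by simp [h₂', reassoc_of% h₁']⟩

end ExactSequences

/-! ### Conflations of the localization and their exactness -/

section LocalizedRealization

variable {C : Type u} [Category.{v} C] [Preadditive C] [HasZeroObject C] [HasBinaryBiproducts C]
  {L : Type u'} [Category.{v'} L] [Preadditive L] {E : Cᵒᵖ ⥤ C ⥤ AddCommGrpCat.{w}}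

section

variable (Q : C ⥤ L) (W : MorphismProperty C) (s : Realization E)

/-- Extensions killed by a morphism of `W` on one side are killed on the other side. -/
structure KilledSymm : Prop where
  pull_killed : ∀ {Z A A' : C} (δ : Ext E Z A) (p : A ⟶ A'), W p → push E p δ = 0 →
    ∃ (Z' : C) (q : Z' ⟶ Z), W q ∧ pull E q δ = 0
  push_killed : ∀ {Z Z' A : C} (δ : Ext E Z A) (q : Z' ⟶ Z), W q → pull E q δ = 0 →
    ∃ (A' : C) (p : A ⟶ A'), W p ∧ push E p δ = 0

variable {Q W s} in
-- If `p` kills `δ`, the lifting hypothesis makes the middle of `δ` isomorphic in `L` to that of a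
-- split conflation, compatibly with the deflations. So `Q.map y` has a section; a roof for it
-- yields `q` in `W` factoring through `y`, and `y` pulls `δ` back to zero. The other half is dual,
-- with a retraction of `Q.map x`.
lemma KilledSymm.of_lifts [Q.IsLocalization W] [W.HasLeftCalculusOfFractions]
    [W.HasRightCalculusOfFractions] (hC : IsWeaklyExtriangulated E s)
    (hlift : ∀ {A B Z A' B' Z' : C} (x : A ⟶ B) (y : B ⟶ Z) (δ : Ext E Z A)
      (x' : A' ⟶ B') (y' : B' ⟶ Z') (δ' : Ext E Z' A') (a : A ⟶ A') (c : Z ⟶ Z'),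
      s x y δ → s x' y' δ' → push E a δ = pull E c δ' → W a → W c →
      ∃ b : Q.obj B ≅ Q.obj B', Q.map x ≫ b.hom = Q.map a ≫ Q.map x' ∧
        Q.map y ≫ Q.map c = b.hom ≫ Q.map y') :
    KilledSymm (E := E) W where
  pull_killed {Z A A'} δ p hp hδ := by
    obtain ⟨B, x, y, h⟩ := hC.assignment.exists_seq δ
    obtain ⟨B', x', y', h'⟩ := hC.assignment.exists_seq (0 : Ext E Z A')
    obtain ⟨b, -, hb⟩ := hlift x y δ x' y' 0 p (𝟙 Z) h h' (by simp [hδ]) hp (W.id_mem _)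
    obtain ⟨k, hk⟩ := (hC.exactSeq h').exists_lift_deflation (𝟙 Z) (by simp)
    obtain ⟨Z', q, f, hq, -, e⟩ := exists_roof Q W (Q.map k ≫ b.inv) (𝟙 Z) y (by
      have : b.inv ≫ Q.map y = Q.map y' := by simpa [Iso.inv_comp_eq] using hb
      rw [Category.assoc, this, ← Q.map_comp, hk])
    refine ⟨Z', q, hq, ?_⟩
    rw [← Category.comp_id q, e, pull_comp, (hC.exactSeq h).pull_eq_zero, pull_zero]
  push_killed {Z Z' A} δ q hq hδ := by
    obtain ⟨B, x, y, h⟩ := hC.assignment.exists_seq δ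
    obtain ⟨B', x', y', h'⟩ := hC.assignment.exists_seq (0 : Ext E Z' A)
    obtain ⟨b, hb, -⟩ := hlift x' y' 0 x y δ (𝟙 A) q h' h (by simp [hδ]) (W.id_mem _) hq
    obtain ⟨k, hk⟩ := (hC.exactSeq h').exists_extend_inflation (𝟙 A) (by simp)
    obtain ⟨A', p, f, hp, -, e⟩ := exists_coroof Q W (b.inv ≫ Q.map k) x (𝟙 A) (by
      have : Q.map x ≫ b.inv = Q.map x' := by simpa [Iso.comp_inv_eq] using hb.symm
      rw [reassoc_of% this, ← Q.map_comp, hk])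
    refine ⟨A', p, hp, ?_⟩
    rw [← Category.id_comp p, e, push_comp, (hC.exactSeq h).push_eq_zero, push_zero]

end

variable {Q : C ⥤ L} {W : MorphismProperty C} [Q.IsLocalization W]
  [W.HasLeftCalculusOfFractions] [W.HasRightCalculusOfFractions]

/-- The realization on the localization: sequences isomorphic to the image of a conflation. -/
def LocSeq (Q : C ⥤ L) (W : MorphismProperty C) [Q.IsLocalization W]
    [W.HasLeftCalculusOfFractions] [W.HasRightCalculusOfFractions] (s : Realization E) :
    Realization (locBifunctor Q E W) := fun A B Z x y θ =>
  ∃ (A' B' Z' : C) (f : A' ⟶ B') (g : B' ⟶ Z') (δ : Ext E Z' A') (a : A ≅ Q.obj A')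
    (b : B ≅ Q.obj B') (c : Z ≅ Q.obj Z'), s f g δ ∧ x ≫ b.hom = a.hom ≫ Q.map f ∧
    y ≫ c.hom = b.hom ≫ Q.map g ∧
    push (locBifunctor Q E W) a.hom θ = pull (locBifunctor Q E W) c.hom (ext Q W δ)

variable [Q.Additive] {s : Realization E}

/-- A morphism to be factored in `L` is replaced by a numerator in `C` for which the vanishing
condition holds on the nose. It factors in `C`, and the denominators are inverted afterwards. -/
lemma exactSeq_map (hC : IsWeaklyExtriangulated E s) (hk : KilledSymm (E := E) W) {A B Z : C}
    {f : A ⟶ B} {g : B ⟶ Z} {δ : Ext E Z A} (h : s f g δ) :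
    ExactSeq (Q.map f) (Q.map g) (ext Q W δ) := by
  have hex := hC.exactSeq h
  have := Localization.essSurj Q W
  refine .mk' (by rw [← Q.map_comp, hex.zero, Q.map_zero])
    (by rw [pull_ext, hex.pull_eq_zero, ext_zero]) (by rw [push_ext, hex.push_eq_zero, ext_zero])
    ?_ ?_ ?_ ?_
  · intro X k hk
    obtain ⟨X', q, l, hq, hl, e⟩ := exists_roof Q W ((Q.objObjPreimageIso X).hom ≫ k) 0 g
      (by simp [hk])
    obtain ⟨m, rfl⟩ := hex.exists_lift l (by simpa using e.symm)
    have := Localization.inverts Q W _ hq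
    refine ⟨(Q.objObjPreimageIso X).inv ≫ inv (Q.map q) ≫ Q.map m, ?_⟩
    rw [← cancel_epi (Q.objObjPreimageIso X).hom, ← cancel_epi (Q.map q), hl]
    simp
  · intro X k hk₀
    obtain ⟨X', q, c, hq, hc⟩ := exists_right_denominator Q W ((Q.objObjPreimageIso X).hom ≫ k)
    have h₀ : ext Q W (pull E c δ) = ext Q W 0 := by
      rw [← pull_ext, ← hc, ext_zero]
      simp only [pull_comp, hk₀, pull_zero]
    obtain ⟨Z', A', q', p', hq', hp', e⟩ := (ext_eq_iff _ _).1 h₀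
    rw [← push_pull, push_zero, pull_zero] at e
    -- Vanishing in `L` involves denominators on both ends, but lifting through `g` needs an honest
    -- zero pull-back. The right denominator `p'` is traded for a left one.
    obtain ⟨Z'', q'', hq'', e'⟩ := hk.pull_killed _ p' hp' e
    obtain ⟨m, hm⟩ := hex.exists_lift_deflation (q'' ≫ q' ≫ c) (by simpa only [pull_comp] using e')
    have := Localization.inverts Q W _ (W.comp_mem _ _ hq'' (W.comp_mem _ _ hq' hq))
    refine ⟨(Q.objObjPreimageIso X).inv ≫ inv (Q.map (q'' ≫ q' ≫ q)) ≫ Q.map m, ?_⟩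
    rw [← cancel_epi (Q.objObjPreimageIso X).hom, ← cancel_epi (Q.map (q'' ≫ q' ≫ q))]
    simp only [Category.assoc, Iso.hom_inv_id_assoc, IsIso.hom_inv_id_assoc, ← Q.map_comp, hm]
    simp [hc]
  · intro X k hk
    obtain ⟨X', p, l, hp, hl, e⟩ := exists_coroof Q W (k ≫ (Q.objObjPreimageIso X).inv) f 0
      (by simp [reassoc_of% hk])
    obtain ⟨m, rfl⟩ := hex.exists_desc l (by simpa using e.symm)
    have := Localization.inverts Q W _ hp
    refine ⟨Q.map m ≫ inv (Q.map p) ≫ (Q.objObjPreimageIso X).hom, ?_⟩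
    rw [← cancel_mono (Q.objObjPreimageIso X).inv, ← cancel_mono (Q.map p), hl]
    simp
  · intro X k hk₀
    obtain ⟨X', p, a, hp, ha⟩ := exists_left_denominator Q W (k ≫ (Q.objObjPreimageIso X).inv)
    have h₀ : ext Q W (push E a δ) = ext Q W 0 := by
      rw [← push_ext, ← ha, ext_zero]
      simp only [push_comp, hk₀, push_zero]
    obtain ⟨Z', A', q', p', hq', hp', e⟩ := (ext_eq_iff _ _).1 h₀
    rw [push_zero, pull_zero] at e
    obtain ⟨A'', p'', hp'', e'⟩ := hk.push_killed _ q' hq' e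
    obtain ⟨m, hm⟩ := hex.exists_extend_inflation (a ≫ p' ≫ p'')
      (by simpa only [push_comp] using e')
    have := Localization.inverts Q W _ (W.comp_mem _ _ hp (W.comp_mem _ _ hp' hp''))
    refine ⟨Q.map m ≫ inv (Q.map (p ≫ p' ≫ p'')) ≫ (Q.objObjPreimageIso X).hom, ?_⟩
    rw [← cancel_mono (Q.objObjPreimageIso X).inv, ← cancel_mono (Q.map (p ≫ p' ≫ p''))]
    simp only [Category.assoc, Iso.hom_inv_id, IsIso.inv_hom_id, Category.comp_id,
      ← Q.map_comp, hm]
    simp [reassoc_of% ha]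

lemma LocSeq.exactSeq (hC : IsWeaklyExtriangulated E s) (hk : KilledSymm (E := E) W) {A B Z : L}
    {x : A ⟶ B} {y : B ⟶ Z} {θ : Ext (locBifunctor Q E W) Z A} (h : LocSeq Q W s x y θ) :
    ExactSeq x y θ := by
  obtain ⟨A', B', Z', f, g, δ, a, b, c, hs, hx, hy, hθ⟩ := h
  have hex := exactSeq_map (Q := Q) hC hk hs
  have hx' : x = a.hom ≫ Q.map f ≫ b.inv := by simp [← reassoc_of% hx]
  have hy' : y = b.hom ≫ Q.map g ≫ c.inv := by simp [← reassoc_of% hy]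
  refine .mk' (by simp [hx', hy', reassoc_of% hex.zero]) ?_ ?_ ?_ ?_ ?_ ?_
  · apply push_hom_injective a
    rw [push_pull, hθ, ← pull_comp, hy, pull_comp, hex.pull_eq_zero, pull_zero, push_zero]
  · apply push_hom_injective b
    rw [← push_comp, hx, push_comp, hθ, push_pull, hex.push_eq_zero, pull_zero, push_zero]
  · intro X k hk
    obtain ⟨m, hm⟩ := hex.exists_lift (k ≫ b.hom) (by simp [← hy, reassoc_of% hk])
    exact ⟨m ≫ a.inv, by simp [hx', reassoc_of% hm]⟩
  · intro X k hk
    obtain ⟨m, hm⟩ := hex.exists_lift_deflation (k ≫ c.hom) (by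
      rw [pull_comp, ← hθ, ← push_pull, hk, push_zero])
    exact ⟨m ≫ b.inv, by simp [hy', reassoc_of% hm]⟩
  · intro X k hk
    obtain ⟨m, hm⟩ := hex.exists_desc (b.inv ≫ k) (by
      rw [← cancel_epi a.hom, ← reassoc_of% hx]
      simp [hk])
    exact ⟨c.hom ≫ m, by simp [hy', hm]⟩
  · intro X k hk
    obtain ⟨m, hm⟩ := hex.exists_extend_inflation (a.inv ≫ k) (by
      apply pull_hom_injective c
      rw [← push_pull, ← hθ, ← push_comp]
      simp [hk])
    exact ⟨b.hom ≫ m, by simp [hx', hm]⟩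

/-- A morphism of extensions in the localization is induced by a morphism between the images of
the realizing conflations. -/
lemma exists_middle_map (hC : IsWeaklyExtriangulated E s) (hk : KilledSymm (E := E) W)
    {A B Z A' B' Z' : C} {x : A ⟶ B} {y : B ⟶ Z} {δ : Ext E Z A} {x' : A' ⟶ B'} {y' : B' ⟶ Z'}
    {δ' : Ext E Z' A'} (h : s x y δ) (h' : s x' y' δ') (α : Q.obj A ⟶ Q.obj A')
    (γ : Q.obj Z ⟶ Q.obj Z')
    (hδ : push (locBifunctor Q E W) α (ext Q W δ) = pull (locBifunctor Q E W) γ (ext Q W δ')) :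
    ∃ b : Q.obj B ⟶ Q.obj B', Q.map x ≫ b = α ≫ Q.map x' ∧ b ≫ Q.map y' = Q.map y ≫ γ := by
  obtain ⟨Z₁, q, c, hq, hc⟩ := exists_right_denominator Q W γ
  obtain ⟨A₁, p, a, hp, ha⟩ := exists_left_denominator Q W α
  have e : ext Q W (pull E q (push E a δ)) = ext Q W (pull E c (push E p δ')) := by
    simp only [← push_ext, ← pull_ext, ← ha, ← hc, push_comp, pull_comp, hδ]
    rw [push_pull]
  obtain ⟨Z₂, A₂, q', p', hq', hp', e⟩ := (ext_eq_iff _ _).1 e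
  -- `M₁` and `M₂` absorb the denominators: `m₁` and `m₂` become invertible in `L` by the five
  -- lemma, while `n` between them already exists in `C`.
  obtain ⟨M₁, u₁, v₁, h₁⟩ := hC.assignment.exists_seq (pull E (q' ≫ q) δ)
  obtain ⟨M₂, u₂, v₂, h₂⟩ := hC.assignment.exists_seq (push E (p ≫ p') δ')
  obtain ⟨m₁, hm₁, hm₁'⟩ := hC.exists_middle h₁ h (𝟙 _) (q' ≫ q) (by simp)
  obtain ⟨m₂, hm₂, hm₂'⟩ := hC.exists_middle h' h₂ (p ≫ p') (𝟙 _) (by simp)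
  obtain ⟨n, hn, hn'⟩ := hC.exists_middle h₁ h₂ (a ≫ p') (q' ≫ c) (by
    simp only [push_comp, pull_comp]
    simpa only [push_pull] using e)
  have := Localization.inverts Q W _ (W.comp_mem _ _ hq' hq)
  have := Localization.inverts Q W _ (W.comp_mem _ _ hp hp')
  have i₁ : IsIso (Q.map m₁) := (exactSeq_map (W := W) hC hk h₁).isIso_middle
    (exactSeq_map hC hk h) (𝟙 _) (Q.map m₁) (Q.map (q' ≫ q)) (by simp [← Q.map_comp, hm₁])
    (by simp only [← Q.map_comp, hm₁']) (by rw [pull_ext, push_id])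
  have i₂ : IsIso (Q.map m₂) := (exactSeq_map (W := W) hC hk h').isIso_middle
    (exactSeq_map hC hk h₂) (Q.map (p ≫ p')) (Q.map m₂) (𝟙 _) (by simp only [← Q.map_comp, hm₂])
    (by simp [← Q.map_comp, hm₂']) (by rw [push_ext, pull_id])
  refine ⟨inv (Q.map m₁) ≫ Q.map n ≫ inv (Q.map m₂), ?_, ?_⟩
  · have e₁ : Q.map x = Q.map u₁ ≫ Q.map m₁ := by simp [← Q.map_comp, hm₁]
    rw [e₁, Category.assoc, IsIso.hom_inv_id_assoc, ← Q.map_comp_assoc, hn,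
      ← cancel_mono (Q.map m₂)]
    rw [Category.assoc, IsIso.inv_hom_id, Category.comp_id, Category.assoc α, ← Q.map_comp x', hm₂]
    simp [← reassoc_of% ha]
  · have e₂ : Q.map y' = Q.map m₂ ≫ Q.map v₂ := by simp [← Q.map_comp, hm₂']
    rw [e₂, ← cancel_epi (Q.map m₁)]
    simp only [Category.assoc, IsIso.inv_hom_id_assoc, IsIso.hom_inv_id_assoc]
    rw [← Q.map_comp, hn', ← Q.map_comp_assoc, hm₁']
    simp [hc]

lemma LocSeq.exists_middle (hC : IsWeaklyExtriangulated E s) (hk : KilledSymm (E := E) W)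
    {A B Z A' B' Z' : L} {x : A ⟶ B} {y : B ⟶ Z} {θ : Ext (locBifunctor Q E W) Z A}
    {x' : A' ⟶ B'} {y' : B' ⟶ Z'} {θ' : Ext (locBifunctor Q E W) Z' A'}
    (h : LocSeq Q W s x y θ) (h' : LocSeq Q W s x' y' θ') (α : A ⟶ A') (γ : Z ⟶ Z')
    (hθ : push _ α θ = pull _ γ θ') :
    ∃ b : B ⟶ B', x ≫ b = α ≫ x' ∧ b ≫ y' = y ≫ γ := by
  obtain ⟨A₁, B₁, Z₁, f₁, g₁, δ₁, a₁, b₁, c₁, hs₁, hx₁, hy₁, hθ₁⟩ := h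
  obtain ⟨A₂, B₂, Z₂, f₂, g₂, δ₂, a₂, b₂, c₂, hs₂, hx₂, hy₂, hθ₂⟩ := h'
  obtain ⟨b, hb, hb'⟩ := exists_middle_map (Q := Q) (W := W) hC hk hs₁ hs₂
    (a₁.inv ≫ α ≫ a₂.hom) (c₁.inv ≫ γ ≫ c₂.hom) (by
      apply pull_hom_injective c₁
      rw [← push_pull, ← hθ₁, ← push_comp, ← pull_comp]
      simp only [Iso.hom_inv_id_assoc]
      rw [push_comp, hθ, push_pull, hθ₂, pull_comp])
  refine ⟨b₁.hom ≫ b ≫ b₂.inv, ?_, ?_⟩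
  · rw [reassoc_of% hx₁, reassoc_of% hb, ← cancel_mono b₂.hom]
    simp [hx₂]
  · rw [← cancel_mono c₂.hom]
    simp [hy₂, hb', ← reassoc_of% hy₁]

/-- Morphisms of extensions with invertible ends have invertible middle. -/
lemma LocSeq.exists_middle_iso (hC : IsWeaklyExtriangulated E s) (hk : KilledSymm (E := E) W)
    {A B Z A' B' Z' : L} {x : A ⟶ B} {y : B ⟶ Z} {θ : Ext (locBifunctor Q E W) Z A}
    {x' : A' ⟶ B'} {y' : B' ⟶ Z'} {θ' : Ext (locBifunctor Q E W) Z' A'}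
    (h : LocSeq Q W s x y θ) (h' : LocSeq Q W s x' y' θ') (α : A ≅ A') (γ : Z ≅ Z')
    (hθ : push _ α.hom θ = pull _ γ.hom θ') :
    ∃ b : B ≅ B', x ≫ b.hom = α.hom ≫ x' ∧ b.hom ≫ y' = y ≫ γ.hom := by
  obtain ⟨b, hb, hb'⟩ := h.exists_middle hC hk h' α.hom γ.hom hθ
  have := (h.exactSeq hC hk).isIso_middle (h'.exactSeq hC hk) α.hom b γ.hom hb hb' hθ
  exact ⟨asIso b, hb, hb'⟩

lemma LocSeq.transport {A B Z A' B' Z' : L} {x : A ⟶ B} {y : B ⟶ Z}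
    {θ : Ext (locBifunctor Q E W) Z A} (h : LocSeq Q W s x y θ) {x' : A' ⟶ B'} {y' : B' ⟶ Z'}
    {θ' : Ext (locBifunctor Q E W) Z' A'} (α : A ≅ A') (β : B ≅ B') (γ : Z ≅ Z')
    (hx : x ≫ β.hom = α.hom ≫ x') (hy : β.hom ≫ y' = y ≫ γ.hom)
    (hθ : push _ α.hom θ = pull _ γ.hom θ') : LocSeq Q W s x' y' θ' := by
  obtain ⟨A₁, B₁, Z₁, f, g, δ, a, b, c, hs, hx₁, hy₁, hθ₁⟩ := h
  refine ⟨A₁, B₁, Z₁, f, g, δ, α.symm ≪≫ a, β.symm ≪≫ b, γ.symm ≪≫ c, hs, ?_, ?_, ?_⟩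
  · rw [← cancel_epi α.hom, ← reassoc_of% hx]
    simp [hx₁]
  · rw [← cancel_epi β.hom, reassoc_of% hy]
    simp [hy₁]
  · apply pull_hom_injective γ
    rw [← push_pull, ← hθ, ← push_comp, ← pull_comp]
    simp [hθ₁]

lemma LocSeq.of_map {A B Z : C} {f : A ⟶ B} {g : B ⟶ Z} {δ : Ext E Z A} (h : s f g δ) :
    LocSeq Q W s (Q.map f) (Q.map g) (ext Q W δ) :=
  ⟨A, B, Z, f, g, δ, Iso.refl _, Iso.refl _, Iso.refl _, h, by simp, by simp, by simp⟩

lemma LocSeq.of_frac {A Z : L} (τ : Frac Q E Z A) {B : C} {f : τ.X ⟶ B} {g : B ⟶ τ.Z}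
    (h : s f g τ.δ) :
    LocSeq Q W s (τ.s.hom ≫ Q.map f) (Q.map g ≫ τ.t.hom) (lmk τ) :=
  (LocSeq.of_map h).transport τ.s.symm (Iso.refl _) τ.t (by simp) (by simp) (by
    apply push_hom_injective τ.s
    rw [push_pull, push_lmk_hom, ← push_comp, ← pull_comp]
    simp)

lemma LocSeq.isClassAssignment (hC : IsWeaklyExtriangulated E s)
    (hk : KilledSymm (E := E) W) : IsClassAssignment (LocSeq Q W s) where
  exists_seq {A Z} θ := by
    obtain ⟨τ, rfl⟩ := lmk_surjective θ
    obtain ⟨B, f, g, h⟩ := hC.assignment.exists_seq τ.δ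
    exact ⟨_, _, _, .of_frac τ h⟩
  iff_equiv {A B B' Z θ x y} h x' y' := by
    constructor
    · intro h'
      obtain ⟨b, hb, hb'⟩ := h.exists_middle_iso hC hk h' (Iso.refl A) (Iso.refl Z) (by simp)
      exact ⟨b, by simpa using hb, by simpa using hb'⟩
    · rintro ⟨b, hb, hb'⟩
      exact h.transport (Iso.refl A) b (Iso.refl Z) (by simp [hb]) (by simp [hb']) (by simp)

/-- The zero extension gives `x` a retraction `r`. The error `𝟙 B - r ≫ x` factors through the zero
object `Z`, so `x` is invertible. -/
lemma LocSeq.zero_right (hC : IsWeaklyExtriangulated E s) (hk : KilledSymm (E := E) W) (A Z : L)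
    (hZ : IsZero Z) : LocSeq Q W s (𝟙 A) (0 : A ⟶ Z) 0 := by
  obtain ⟨B, x, y, h⟩ := (isClassAssignment (Q := Q) hC hk).exists_seq
    (0 : Ext (locBifunctor Q E W) Z A)
  have hex := h.exactSeq hC hk
  obtain ⟨r, hr⟩ := hex.exists_extend_inflation (𝟙 A) (by simp)
  obtain ⟨k, hk'⟩ := hex.exists_desc (𝟙 B - r ≫ x) (by simp [reassoc_of% hr])
  refine h.transport (Iso.refl A) ⟨r, x, ?_, hr⟩ (Iso.refl Z) (by simpa using hr)
    (hZ.eq_of_tgt _ _) (by simp)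
  rw [hZ.eq_of_src k 0, comp_zero] at hk'
  exact (sub_eq_zero.1 hk'.symm).symm

lemma LocSeq.zero_left (hC : IsWeaklyExtriangulated E s) (hk : KilledSymm (E := E) W) (A Z : L)
    (hA : IsZero A) : LocSeq Q W s (0 : A ⟶ Z) (𝟙 Z) 0 := by
  obtain ⟨B, x, y, h⟩ := (isClassAssignment (Q := Q) hC hk).exists_seq
    (0 : Ext (locBifunctor Q E W) Z A)
  have hex := h.exactSeq hC hk
  obtain ⟨r, hr⟩ := hex.exists_lift_deflation (𝟙 Z) (by simp)
  obtain ⟨k, hk'⟩ := hex.exists_lift (𝟙 B - y ≫ r) (by simp [hr])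
  refine h.transport (Iso.refl A) ⟨y, r, ?_, hr⟩ (Iso.refl Z)
    (hA.eq_of_src _ _) (by simp) (by simp)
  rw [hA.eq_of_tgt k 0, zero_comp] at hk'
  exact (sub_eq_zero.1 hk'.symm).symm

end LocalizedRealization

/-! ### Axioms of an extriangulated category, monos and epis in the localization -/

section LocalizedExact

variable {C : Type u} [Category.{v} C] [Preadditive C] [HasZeroObject C] [HasBinaryBiproducts C]
  {L : Type u'} [Category.{v'} L] [Preadditive L] [HasBinaryBiproducts L]
  {E : Cᵒᵖ ⥤ C ⥤ AddCommGrpCat.{w}} {Q : C ⥤ L} {W : MorphismProperty C} [Q.IsLocalization W]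
  [W.HasLeftCalculusOfFractions] [W.HasRightCalculusOfFractions] [Q.Additive] {s : Realization E}

/-- An additive functor carries a biproduct to the biproduct of isomorphic objects. -/
noncomputable def biprodMapIso (Q : C ⥤ L) [Q.Additive] {A B : L} {X Y : C} (a : A ≅ Q.obj X)
    (b : B ≅ Q.obj Y) : A ⊞ B ≅ Q.obj (X ⊞ Y) where
  hom := biprod.desc (a.hom ≫ Q.map biprod.inl) (b.hom ≫ Q.map biprod.inr)
  inv := biprod.lift (Q.map biprod.fst ≫ a.inv) (Q.map biprod.snd ≫ b.inv)
  hom_inv_id := by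
    ext <;> simp [← Functor.map_comp_assoc, -Functor.map_comp]
  inv_hom_id := by
    simp [← Functor.map_comp, ← Functor.map_add]

lemma lift_biprodMapIso {A B T : L} {X Y : C} (a : A ≅ Q.obj X) (b : B ≅ Q.obj Y) (f : T ⟶ A)
    (g : T ⟶ B) {T' : C} (u : T ⟶ Q.obj T') (f' : T' ⟶ X) (g' : T' ⟶ Y)
    (hf : f ≫ a.hom = u ≫ Q.map f') (hg : g ≫ b.hom = u ≫ Q.map g') :
    biprod.lift f g ≫ (biprodMapIso Q a b).hom = u ≫ Q.map (biprod.lift f' g') := by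
  have e : biprod.lift f' g' = f' ≫ biprod.inl + g' ≫ biprod.inr := by ext <;> simp
  simp [e, biprodMapIso, reassoc_of% hf, reassoc_of% hg, biprod.lift_desc]

lemma desc_biprodMapIso {A B T : L} {X Y : C} (a : A ≅ Q.obj X) (b : B ≅ Q.obj Y) (f : A ⟶ T)
    (g : B ⟶ T) {T' : C} (u : T ⟶ Q.obj T') (f' : X ⟶ T') (g' : Y ⟶ T')
    (hf : f ≫ u = a.hom ≫ Q.map f') (hg : g ≫ u = b.hom ≫ Q.map g') :
    biprod.desc f g ≫ u = (biprodMapIso Q a b).hom ≫ Q.map (biprod.desc f' g') := by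
  ext <;> simp [biprodMapIso, hf, hg, ← Functor.map_comp]

/-- With `A'` identified suitably with some `Q.obj A₂`, the morphism `α` becomes the image of a
morphism `l` of `C`. The square and its biproduct conflation come from `C`, and uniqueness of
realizations (`φ`) moves them to the given sequences. -/
lemma LocSeq.push_square (hC : IsWeaklyExtriangulated E s) (hk : KilledSymm (E := E) W)
    {A B Z A' B' : L} {x : A ⟶ B} {y : B ⟶ Z} {θ : Ext (locBifunctor Q E W) Z A} (α : A ⟶ A')
    {x' : A' ⟶ B'} {y' : B' ⟶ Z} (h : LocSeq Q W s x y θ)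
    (h' : LocSeq Q W s x' y' (push (locBifunctor Q E W) α θ)) :
    ∃ b : B ⟶ B', x ≫ b = α ≫ x' ∧ b ≫ y' = y ∧
      LocSeq Q W s (biprod.lift x α) (biprod.desc b (-x')) (pull (locBifunctor Q E W) y' θ) := by
  have := Localization.essSurj Q W
  obtain ⟨A₁, B₁, Z₁, f, g, δ, a, b, c, hs, hx, hy, hθ⟩ := h
  obtain ⟨A₂, p, l, hp, hl⟩ := exists_left_denominator Q W
    (a.inv ≫ α ≫ (Q.objObjPreimageIso A').inv)
  let u : A' ≅ Q.obj A₂ := (Q.objObjPreimageIso A').symm ≪≫ wIso Q W p hp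
  have hu : α ≫ u.hom = a.hom ≫ Q.map l := by simp [u, ← hl]
  obtain ⟨Y, f', g', hs'⟩ := hC.assignment.exists_seq (push E l δ)
  obtain ⟨m, hm, hm', hs''⟩ := hC.push_square l hs hs'
  obtain ⟨φ, hφ, hφ'⟩ := h'.exists_middle_iso hC hk (LocSeq.of_map hs') u c (by
    rw [← push_comp, hu, push_comp, hθ, push_pull, push_ext])
  refine ⟨b.hom ≫ Q.map m ≫ φ.inv, ?_, ?_, _, _, _, _, _, _, a, biprodMapIso Q b u, φ, hs'',
    ?_, ?_, ?_⟩
  · rw [reassoc_of% hx, ← cancel_mono φ.hom]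
    have e : Q.map f ≫ Q.map m = Q.map l ≫ Q.map f' := by simp only [← Q.map_comp, hm]
    simp [hφ, reassoc_of% hu, e]
  · rw [← cancel_mono c.hom]
    simp [← hφ', hy, ← hm']
  · exact lift_biprodMapIso _ _ _ _ _ _ _ hx hu
  · exact desc_biprodMapIso _ _ _ _ _ _ _ (by simp) (by simp [hφ])
  · rw [push_pull, hθ, ← pull_comp, ← hφ', pull_comp, pull_ext]

lemma LocSeq.pull_square (hC : IsWeaklyExtriangulated E s) (hk : KilledSymm (E := E) W)
    {A B Z B' Z' : L} {x : A ⟶ B} {y : B ⟶ Z} {θ : Ext (locBifunctor Q E W) Z A} (γ : Z' ⟶ Z)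
    {x' : A ⟶ B'} {y' : B' ⟶ Z'} (h : LocSeq Q W s x y θ)
    (h' : LocSeq Q W s x' y' (pull (locBifunctor Q E W) γ θ)) :
    ∃ b : B' ⟶ B, x' ≫ b = x ∧ b ≫ y = y' ≫ γ ∧
      LocSeq Q W s (biprod.lift (-y') b) (biprod.desc γ y)
        (push (locBifunctor Q E W) x' θ) := by
  have := Localization.essSurj Q W
  obtain ⟨A₁, B₁, Z₁, f, g, δ, a, b, c, hs, hx, hy, hθ⟩ := h
  obtain ⟨Z₂, q, l, hq, hl⟩ := exists_right_denominator Q W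
    ((Q.objObjPreimageIso Z').hom ≫ γ ≫ c.hom)
  let u : Z' ≅ Q.obj Z₂ := (wIso Q W q hq ≪≫ Q.objObjPreimageIso Z').symm
  have hu : γ ≫ c.hom = u.hom ≫ Q.map l := by
    rw [← Iso.inv_comp_eq]
    simp [u, ← hl]
  obtain ⟨Y, f', g', hs'⟩ := hC.assignment.exists_seq (pull E l δ)
  obtain ⟨m, hm, hm', hs''⟩ := hC.pull_square l hs hs'
  obtain ⟨φ, hφ, hφ'⟩ := h'.exists_middle_iso hC hk (LocSeq.of_map hs') a u (by
    rw [push_pull, hθ, ← pull_comp, hu, pull_comp, pull_ext])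
  refine ⟨φ.hom ≫ Q.map m ≫ b.inv, ?_, ?_, _, _, _, _, _, _, φ, biprodMapIso Q u b, c, hs'',
    ?_, ?_, ?_⟩
  · rw [reassoc_of% hφ, ← cancel_mono b.hom]
    simp [hx, ← Q.map_comp, hm]
  · rw [← cancel_mono c.hom]
    have e : Q.map m ≫ Q.map g = Q.map g' ≫ Q.map l := by simp only [← Q.map_comp, hm']
    simp [hu, hy, ← reassoc_of% hφ', e]
  · exact lift_biprodMapIso _ _ _ _ _ _ _ (by simp [hφ']) (by simp)
  · exact desc_biprodMapIso _ _ _ _ _ _ _ hu hy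
  · rw [← push_comp, hφ, push_comp, hθ, push_pull, push_ext]

lemma LocSeq.isInflation_map {A B : C} {f : A ⟶ B} (hf : IsInflation s f) {A' B' : L}
    (u : A' ≅ Q.obj A) (v : Q.obj B ≅ B') :
    IsInflation (LocSeq Q W s) (u.hom ≫ Q.map f ≫ v.hom) := by
  obtain ⟨Z, g, δ, h⟩ := hf
  exact ⟨_, v.inv ≫ Q.map g, push _ u.inv (ext Q W δ), (LocSeq.of_map h).transport u.symm v
    (Iso.refl _) (by simp) (by simp) (by simp)⟩

lemma LocSeq.isDeflation_map {A B : C} {f : A ⟶ B} (hf : IsDeflation s f) {A' B' : L}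
    (u : A' ≅ Q.obj A) (v : Q.obj B ≅ B') :
    IsDeflation (LocSeq Q W s) (u.hom ≫ Q.map f ≫ v.hom) := by
  obtain ⟨Z, g, δ, h⟩ := hf
  exact ⟨_, Q.map g ≫ u.inv, pull _ v.inv (ext Q W δ), (LocSeq.of_map h).transport (Iso.refl _)
    u.symm v (by simp) (by simp) (by
      apply pull_hom_injective v.symm
      rw [← pull_comp, ← pull_comp]
      simp)⟩

lemma LocSeq.exists_of_isInflation {A B : L} {x : A ⟶ B} (hx : IsInflation (LocSeq Q W s) x) :
    ∃ (A' B' : C) (f : A' ⟶ B') (u : A ≅ Q.obj A') (v : Q.obj B' ≅ B), IsInflation s f ∧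
      x = u.hom ≫ Q.map f ≫ v.hom := by
  obtain ⟨Z, y, θ, A', B', Z', f, g, δ, a, b, c, hs, hx, -⟩ := hx
  exact ⟨A', B', f, a, b.symm, ⟨_, _, _, hs⟩, by simp [← reassoc_of% hx]⟩

lemma LocSeq.exists_of_isDeflation {B Z : L} {y : B ⟶ Z} (hy : IsDeflation (LocSeq Q W s) y) :
    ∃ (B' Z' : C) (g : B' ⟶ Z') (u : B ≅ Q.obj B') (v : Q.obj Z' ≅ Z), IsDeflation s g ∧
      y = u.hom ≫ Q.map g ≫ v.hom := by
  obtain ⟨A, x, θ, A', B', Z', f, g, δ, a, b, c, hs, -, hy, -⟩ := hy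
  exact ⟨B', Z', g, b, c.symm, ⟨_, _, _, hs⟩, by simp [← reassoc_of% hy]⟩

/-- An inflation out of the image of an object is given by an inflation after a morphism
of `W`. -/
lemma LocSeq.exists_of_isInflation' (hC : IsWeaklyExtriangulated E s)
    (hk : KilledSymm (E := E) W) {A : C} {B : L} {x : Q.obj A ⟶ B}
    (hx : IsInflation (LocSeq Q W s) x) :
    ∃ (A' B' : C) (p : A ⟶ A') (f : A' ⟶ B') (v : Q.obj B' ≅ B), W p ∧ IsInflation s f ∧
      x = Q.map p ≫ Q.map f ≫ v.hom := by
  have := Localization.essSurj Q W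
  obtain ⟨Z, y, θ, h⟩ := hx
  -- Taking the identity of `Q.obj A` as reference makes the left end an actual morphism `p` of `W`,
  -- not just an isomorphism of `L`; `CompStable` needs this.
  obtain ⟨Z', A', q, p, hq, hp, δ, rfl⟩ := exists_lmk (Q.objObjPreimageIso Z) (Iso.refl _) θ
  obtain ⟨B', f, g, hs⟩ := hC.assignment.exists_seq δ
  obtain ⟨v, hv, -⟩ := (LocSeq.of_frac (s := s) (W := W) ⟨_, _,
    wIso Q W q hq ≪≫ Q.objObjPreimageIso Z, δ, Iso.refl _ ≪≫ wIso Q W p hp⟩ hs).exists_middle_iso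
    hC hk h (Iso.refl _) (Iso.refl _) (by simp)
  exact ⟨A', B', p, f, v, hp, ⟨_, _, _, hs⟩, by simpa using hv.symm⟩

/-- A deflation onto the image of an object is given by a deflation before a morphism of `W`. -/
lemma LocSeq.exists_of_isDeflation' (hC : IsWeaklyExtriangulated E s)
    (hk : KilledSymm (E := E) W) {B : L} {Z : C} {y : B ⟶ Q.obj Z}
    (hy : IsDeflation (LocSeq Q W s) y) :
    ∃ (B' Z' : C) (g : B' ⟶ Z') (q : Z' ⟶ Z) (u : B ≅ Q.obj B'), W q ∧ IsDeflation s g ∧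
      y = u.hom ≫ Q.map g ≫ Q.map q := by
  have := Localization.essSurj Q W
  obtain ⟨A, x, θ, h⟩ := hy
  obtain ⟨Z', A', q, p, hq, hp, δ, rfl⟩ :=
    exists_lmk (Iso.refl _) (Q.objObjPreimageIso A).symm θ
  obtain ⟨B', f, g, hs⟩ := hC.assignment.exists_seq δ
  obtain ⟨v, -, hv⟩ := h.exists_middle_iso hC hk
    (LocSeq.of_frac (s := s) (W := W) ⟨_, _, wIso Q W q hq ≪≫ Iso.refl _, δ,
      (Q.objObjPreimageIso A).symm ≪≫ wIso Q W p hp⟩ hs) (Iso.refl _) (Iso.refl _) (by simp)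
  exact ⟨B', Z', g, q, v, hq, ⟨_, _, _, hs⟩, by simpa using hv.symm⟩

variable (Q W s) in
/-- The composite of two inflations, or of two deflations, with a morphism of `W` in between is
again one up to isomorphism in the localization. -/
structure CompStable : Prop where
  inflation : ∀ {X Y X' Y' : C} (f : X ⟶ Y) (p : Y ⟶ X') (f' : X' ⟶ Y'), IsInflation s f → W p →
    IsInflation s f' → ∃ (A B : C) (u : Q.obj X ≅ Q.obj A) (x : A ⟶ B) (v : Q.obj B ≅ Q.obj Y'),
      IsInflation s x ∧ u.hom ≫ Q.map x ≫ v.hom = Q.map f ≫ Q.map p ≫ Q.map f'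
  deflation : ∀ {X Y X' Y' : C} (f : X ⟶ Y) (p : Y ⟶ X') (f' : X' ⟶ Y'), IsDeflation s f → W p →
    IsDeflation s f' → ∃ (A B : C) (u : Q.obj X ≅ Q.obj A) (x : A ⟶ B) (v : Q.obj B ≅ Q.obj Y'),
      IsDeflation s x ∧ u.hom ≫ Q.map x ≫ v.hom = Q.map f ≫ Q.map p ≫ Q.map f'

/-- The localization is an extriangulated category. -/
theorem LocSeq.isExtriangulated [HasZeroObject L] (hC : IsExtriangulated E s)
    (hk : KilledSymm (E := E) W) (hcomp : CompStable Q W s) :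
    IsExtriangulated (locBifunctor Q E W) (LocSeq Q W s) where
  biadditive := locBifunctor_biadditive hC.biadditive
  assignment := isClassAssignment hC.toIsWeaklyExtriangulated hk
  exact_comp_left h := (h.exactSeq hC.toIsWeaklyExtriangulated hk).left
  exact_comp_right h := (h.exactSeq hC.toIsWeaklyExtriangulated hk).right
  zero_right := LocSeq.zero_right hC.toIsWeaklyExtriangulated hk
  zero_left := LocSeq.zero_left hC.toIsWeaklyExtriangulated hk
  push_square α _ _ h h' := h.push_square hC.toIsWeaklyExtriangulated hk α h'
  pull_square γ _ _ h h' := h.pull_square hC.toIsWeaklyExtriangulated hk γ h'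
  inflation_comp x x' hx hx' := by
    obtain ⟨A, B, f, u, v, hf, rfl⟩ := exists_of_isInflation hx
    -- The isomorphism `v` is moved into the second inflation, which then starts at the image of an
    -- object of `C`.
    have h₂ : IsInflation (LocSeq Q W s) (v.hom ≫ x') := by
      obtain ⟨Z, y, θ, h⟩ := hx'
      exact ⟨Z, y, _, h.transport v.symm (Iso.refl _) (Iso.refl _) (by simp) (by simp)
        (pull_id _).symm⟩
    obtain ⟨A', B', p, f', v', hp, hf', e⟩ :=
      exists_of_isInflation' hC.toIsWeaklyExtriangulated hk h₂
    obtain ⟨A'', B'', u'', f'', v'', hf'', e'⟩ := hcomp.inflation f p f' hf hp hf'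
    have := isInflation_map (W := W) hf'' (u ≪≫ u'') (v'' ≪≫ v')
    simpa [reassoc_of% e', e] using this
  deflation_comp y y' hy hy' := by
    obtain ⟨B, Z, g, u, v, hg, rfl⟩ := exists_of_isDeflation hy'
    have h₂ : IsDeflation (LocSeq Q W s) (y ≫ u.hom) := by
      obtain ⟨A, x, θ, h⟩ := hy
      refine ⟨A, x, pull _ u.inv θ, h.transport (Iso.refl _) (Iso.refl _) u (by simp) (by simp) ?_⟩
      rw [← pull_comp]
      simp
    obtain ⟨B', Z', g', q, v', hq, hg', e⟩ :=
      exists_of_isDeflation' hC.toIsWeaklyExtriangulated hk h₂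
    obtain ⟨A'', B'', u'', f'', v'', hf'', e'⟩ := hcomp.deflation g' q g hg' hq hg
    have := isDeflation_map (W := W) hf'' (v' ≪≫ u'') (v'' ≪≫ v)
    simpa [reassoc_of% e', reassoc_of% e] using this

/-- The localization corresponds to an exact category. -/
theorem LocSeq.correspondsToExact [HasZeroObject L] (hC : IsExtriangulated E s)
    (hk : KilledSymm (E := E) W) (hcomp : CompStable Q W s)
    (hinf : ∀ {X A B : C} (x : A ⟶ B) (f : X ⟶ A), IsInflation s x → f ≫ x = 0 → Q.map f = 0)
    (hdef : ∀ {B Z X : C} (y : B ⟶ Z) (g : Z ⟶ X), IsDeflation s y → y ≫ g = 0 → Q.map g = 0) :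
    CorrespondsToExact (locBifunctor Q E W) (LocSeq Q W s) where
  extriangulated := isExtriangulated hC hk hcomp
  mono_of_inflation x hx := by
    have := Localization.essSurj Q W
    obtain ⟨A, B, f, u, v, hf, rfl⟩ := exists_of_isInflation hx
    have : Mono (Q.map f) := Preadditive.mono_of_cancel_zero _ fun {X} g hg => by
      -- The numerator `l` of `g` satisfies `l ≫ f = 0` in `C`, so `hinf` applies to it.
      obtain ⟨X', q, l, hq, hl, e⟩ := exists_roof Q W ((Q.objObjPreimageIso X).hom ≫ g) 0 f
        (by simp [hg])
      have := Localization.inverts Q W _ hq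
      rw [← cancel_epi (Q.objObjPreimageIso X).hom, ← cancel_epi (Q.map q), hl,
        hinf f l hf (by simpa using e.symm)]
      simp
    infer_instance
  epi_of_deflation y hy := by
    have := Localization.essSurj Q W
    obtain ⟨A, B, f, u, v, hf, rfl⟩ := exists_of_isDeflation hy
    have : Epi (Q.map f) := Preadditive.epi_of_cancel_zero _ fun {X} g hg => by
      obtain ⟨X', q, l, hq, hl, e⟩ := exists_coroof Q W (g ≫ (Q.objObjPreimageIso X).inv) f 0
        (by simp [reassoc_of% hg])
      have := Localization.inverts Q W _ hq
      rw [← cancel_mono (Q.objObjPreimageIso X).inv, ← cancel_mono (Q.map q), hl,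
        hdef f l hf (by simpa using e.symm)]
      simp
    infer_instance

/-- Admissibility of all morphisms passes to the localization. -/
lemma LocSeq.isAdmissible (h : ∀ ⦃A B : C⦄ (f : A ⟶ B), IsAdmissible s f) ⦃A B : L⦄ (f : A ⟶ B) :
    IsAdmissible (LocSeq Q W s) f := by
  have := Localization.essSurj Q W
  obtain ⟨X, q, l, hq, hl⟩ := exists_right_denominator Q W
    ((Q.objObjPreimageIso A).hom ≫ f ≫ (Q.objObjPreimageIso B).inv)
  obtain ⟨I, g, m, hg, hm, rfl⟩ := h l
  obtain ⟨i, hi⟩ : ∃ i : Q.obj X ≅ A, i.hom = Q.map q ≫ (Q.objObjPreimageIso A).hom :=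
    ⟨wIso Q W q hq ≪≫ Q.objObjPreimageIso A, rfl⟩
  have e : Q.map g ≫ Q.map m = i.hom ≫ f ≫ (Q.objObjPreimageIso B).inv := by
    rw [← Q.map_comp, ← hl, hi, Category.assoc]
  exact ⟨_, _, _, isDeflation_map hg i.symm (Iso.refl _),
    isInflation_map hm (Iso.refl _) (Q.objObjPreimageIso B), by simp [reassoc_of% e]⟩

end LocalizedExact

/-! ### Exact categories with all morphisms admissible -/

section Abelian

variable {C : Type u} [Category.{v} C] [Preadditive C] [HasZeroObject C] [HasBinaryBiproducts C]
  {E : Cᵒᵖ ⥤ C ⥤ AddCommGrpCat.{w}} {s : Realization E}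

/-- The inflation before a monic deflation is zero, so the identity factors through `f`. -/
lemma CorrespondsToExact.isIso_of_mono (h : CorrespondsToExact E s) {A B : C} {f : A ⟶ B}
    (hf : IsDeflation s f) [Mono f] : IsIso f := by
  obtain ⟨K, x, δ, hx⟩ := hf
  have hex := h.extriangulated.exactSeq hx
  have : x = 0 := by rw [← cancel_mono f, hex.zero, zero_comp]
  obtain ⟨k, hk⟩ := hex.exists_desc (𝟙 A) (by simp [this])
  have := h.epi_of_deflation f ⟨_, _, _, hx⟩
  exact ⟨k, hk, by rw [← cancel_epi f, reassoc_of% hk, Category.comp_id]⟩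

lemma CorrespondsToExact.isIso_of_epi (h : CorrespondsToExact E s) {A B : C} {f : A ⟶ B}
    (hf : IsInflation s f) [Epi f] : IsIso f := by
  obtain ⟨Z, y, δ, hy⟩ := hf
  have hex := h.extriangulated.exactSeq hy
  have : y = 0 := by rw [← cancel_epi f, hex.zero, comp_zero]
  obtain ⟨k, hk⟩ := hex.exists_lift (𝟙 B) (by simp [this])
  have := h.mono_of_inflation f ⟨_, _, _, hy⟩
  exact ⟨k, by rw [← cancel_mono f, Category.assoc, hk, Category.comp_id, Category.id_comp], hk⟩

/-- An exact category in which every morphism is admissible is abelian. -/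
theorem CorrespondsToExact.exists_abelian (h : CorrespondsToExact E s)
    (hadm : ∀ ⦃A B : C⦄ (f : A ⟶ B), IsAdmissible s f) :
    ∃ hA : Abelian C, hA.toPreadditive = (inferInstance : Preadditive C) := by
  -- As `m` is mono, the kernel of `e ≫ m` is that of `e`, namely the inflation of its conflation.
  have hker : HasKernels C := ⟨fun {A B} f => by
    obtain ⟨I, e, m, ⟨K, x, δ, hx⟩, hm, rfl⟩ := hadm f
    have := h.mono_of_inflation m hm
    have := h.mono_of_inflation x ⟨_, _, _, hx⟩
    have hex := h.extriangulated.exactSeq hx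
    exact ⟨_, KernelFork.IsLimit.ofι' x (by simp [reassoc_of% hex.zero]) fun k hk =>
      have := hex.exists_lift k (by rw [← cancel_mono m]; simpa using hk)
      ⟨this.choose, this.choose_spec⟩⟩⟩
  have hcoker : HasCokernels C := ⟨fun {A B} f => by
    obtain ⟨I, e, m, he, ⟨Z, y, δ, hy⟩, rfl⟩ := hadm f
    have := h.epi_of_deflation e he
    have := h.epi_of_deflation y ⟨_, _, _, hy⟩
    have hex := h.extriangulated.exactSeq hy
    exact ⟨_, CokernelCofork.IsColimit.ofπ' y (by simp [hex.zero]) fun k hk =>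
      have := hex.exists_desc k (by rw [← cancel_epi e]; simpa using hk)
      ⟨this.choose, this.choose_spec⟩⟩⟩
  have hmono : IsNormalMonoCategory C := ⟨fun {A B} f hf => by
    obtain ⟨I, e, m, he, ⟨Z, y, δ, hy⟩, rfl⟩ := hadm f
    have : Mono e := mono_of_mono e m
    -- Up to this isomorphism `f` is the inflation `m`, the kernel of its deflation `y`.
    have := h.isIso_of_mono he
    have hex := h.extriangulated.exactSeq hy
    exact ⟨⟨Z, y, by simp [hex.zero], KernelFork.IsLimit.ofι' _ _ fun k hk =>
      have := hex.exists_lift k hk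
      ⟨this.choose ≫ inv e, by simp [this.choose_spec]⟩⟩⟩⟩
  have hepi : IsNormalEpiCategory C := ⟨fun {A B} f hf => by
    obtain ⟨I, e, m, ⟨K, x, δ, hx⟩, hm, rfl⟩ := hadm f
    have : Epi m := epi_of_epi e m
    have := h.isIso_of_epi hm
    have hex := h.extriangulated.exactSeq hx
    exact ⟨⟨K, x, by simp [reassoc_of% hex.zero], CokernelCofork.IsColimit.ofπ' _ _ fun k hk =>
      have := hex.exists_desc k hk
      ⟨inv m ≫ this.choose, by simp [this.choose_spec]⟩⟩⟩⟩
  have hprod : HasFiniteProducts C := by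
    have := hasBinaryProducts_of_hasBinaryBiproducts (C := C)
    exact hasFiniteProducts_of_has_binary_and_terminal
  exact ⟨{ }, rfl⟩

end Abelian

/-! ### `Q` as a localization of `C` with both calculi of fractions -/

section Numerators

variable {C : Type u} [Category.{v} C] [Preadditive C] [HasZeroObject C] [HasBinaryBiproducts C]
  (S : MorphismProperty C)

/-- The morphisms of `C` whose class lies in `closureS S`. -/
abbrev preS : MorphismProperty C := (closureS S).inverseImage (proj S)

variable {S} [IsSumClosed S]

lemma proj_map_eq_zero {X Y : C} {f : X ⟶ Y} (hf : FactorsThroughNull S f) :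
    (proj S).map f = 0 := by
  rw [← (proj S).map_zero, CategoryTheory.Quotient.functor_map_eq_iff]
  rwa [← sub_zero f] at hf

variable [(closureS S).HasLeftCalculusOfFractions] [(closureS S).HasRightCalculusOfFractions]

/-- A morphism inverted by `Q` becomes a morphism of `preS S` after precomposition. -/
lemma exists_precomp_preS {A B : C} (f : A ⟶ B) (hf : IsIso ((Q S).map f)) :
    ∃ (A' : C) (g : A' ⟶ A), preS S (g ≫ f) := by
  have : IsIso ((QBar S).map ((proj S).map f)) := hf
  -- `closureS S` is not assumed saturated. A roof for the inverse of the image of `f`, commuting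
  -- strictly over the target, has denominator `g ≫ f` in `closureS S`.
  obtain ⟨X, q, g, hq, hg, e⟩ := exists_roof (QBar S) (closureS S)
    (inv ((QBar S).map ((proj S).map f))) (𝟙 _) ((proj S).map f) (by simp)
  obtain ⟨l, hl⟩ := (proj S).map_surjective (X := X.as) g
  refine ⟨X.as, l, ?_⟩
  rw [Category.comp_id] at e
  change closureS S ((proj S).map (l ≫ f))
  rw [(proj S).map_comp, hl]
  exact e ▸ hq

/-- A morphism inverted by `Q` becomes a morphism of `preS S` after postcomposition. -/
lemma exists_postcomp_preS {A B : C} (f : A ⟶ B) (hf : IsIso ((Q S).map f)) :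
    ∃ (B' : C) (g : B ⟶ B'), preS S (f ≫ g) := by
  have : IsIso ((QBar S).map ((proj S).map f)) := hf
  obtain ⟨X, q, g, hq, hg, e⟩ := exists_coroof (QBar S) (closureS S)
    (inv ((QBar S).map ((proj S).map f))) ((proj S).map f) (𝟙 _) (by simp)
  obtain ⟨l, hl⟩ := (proj S).map_surjective (Y := X.as) g
  refine ⟨X.as, l, ?_⟩
  rw [Category.id_comp] at e
  change closureS S ((proj S).map (f ≫ l))
  rw [(proj S).map_comp, hl]
  exact e ▸ hq

/-- Morphisms with the same class are equalized by a morphism of `preS S`. -/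
lemma KillsNull.exists_precomp (h : KillsNull S) {X Y : C} {f g : X ⟶ Y}
    (hfg : (proj S).map f = (proj S).map g) : ∃ (X' : C) (q : X' ⟶ X), preS S q ∧ q ≫ f = q ≫ g := by
  obtain ⟨N, i, j, hN, e⟩ := (CategoryTheory.Quotient.functor_map_eq_iff _ _ _).1 hfg
  obtain ⟨A, q, hq, hiso⟩ := h.target i hN
  obtain ⟨A', l, hl⟩ := exists_precomp_preS q hiso
  refine ⟨A', l ≫ q, hl, ?_⟩
  rw [← sub_eq_zero, ← Preadditive.comp_sub, ← e, Category.assoc, reassoc_of% hq, zero_comp,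
    comp_zero]

/-- Morphisms with the same class are coequalized by a morphism of `preS S`. -/
lemma KillsNull.exists_postcomp (h : KillsNull S) {X Y : C} {f g : X ⟶ Y}
    (hfg : (proj S).map f = (proj S).map g) : ∃ (Y' : C) (p : Y ⟶ Y'), preS S p ∧ f ≫ p = g ≫ p := by
  obtain ⟨N, i, j, hN, e⟩ := (CategoryTheory.Quotient.functor_map_eq_iff _ _ _).1 hfg
  obtain ⟨A, p, hp, hiso⟩ := h.source j hN
  obtain ⟨A', l, hl⟩ := exists_postcomp_preS p hiso
  refine ⟨A', p ≫ l, hl, ?_⟩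
  rw [← sub_eq_zero, ← Preadditive.sub_comp, ← e, Category.assoc, reassoc_of% hp, zero_comp,
    comp_zero]

/-- Solutions in the ideal quotient lift to `C` but commute only modulo the ideal; one more morphism
of `preS S` makes them commute strictly. -/
lemma KillsNull.hasLeftCalculusOfFractions (h : KillsNull S) :
    (preS S).HasLeftCalculusOfFractions where
  exists_leftFraction {X Y} φ := by
    obtain ⟨ψ, hψ⟩ := (MorphismProperty.RightFraction.mk (W := closureS S) ((proj S).map φ.s) φ.hs
      ((proj S).map φ.f)).exists_leftFraction
    obtain @⟨Y', f, p, hp⟩ := ψ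
    obtain ⟨f, rfl⟩ := (proj S).map_surjective (Y := Y'.as) f
    obtain ⟨p, rfl⟩ := (proj S).map_surjective (Y := Y'.as) p
    dsimp only at hψ
    rw [← (proj S).map_comp, ← (proj S).map_comp] at hψ
    obtain ⟨Y'', r, hr, e⟩ := h.exists_postcomp hψ
    exact ⟨⟨f ≫ r, p ≫ r, (preS S).comp_mem _ _ hp hr⟩, by simpa using e⟩
  ext {X' X Y} f₁ f₂ q hq e := by
    obtain ⟨Y', t, ht, e'⟩ := MorphismProperty.HasLeftCalculusOfFractions.ext (W := closureS S)
      ((proj S).map f₁) ((proj S).map f₂) ((proj S).map q) hq (by simp only [← (proj S).map_comp, e])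
    obtain ⟨t, rfl⟩ := (proj S).map_surjective (Y := Y'.as) t
    rw [← (proj S).map_comp, ← (proj S).map_comp] at e'
    obtain ⟨Y'', r, hr, e⟩ := h.exists_postcomp e'
    exact ⟨Y'', t ≫ r, (preS S).comp_mem _ _ ht hr, by simpa using e⟩

lemma KillsNull.hasRightCalculusOfFractions (h : KillsNull S) :
    (preS S).HasRightCalculusOfFractions where
  exists_rightFraction {X Y} φ := by
    obtain ⟨ψ, hψ⟩ := (MorphismProperty.LeftFraction.mk (W := closureS S) ((proj S).map φ.f)
      ((proj S).map φ.s) φ.hs).exists_rightFraction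
    obtain @⟨X', q, hq, f⟩ := ψ
    obtain ⟨f, rfl⟩ := (proj S).map_surjective (X := X'.as) f
    obtain ⟨q, rfl⟩ := (proj S).map_surjective (X := X'.as) q
    dsimp only at hψ
    rw [← (proj S).map_comp, ← (proj S).map_comp] at hψ
    obtain ⟨X'', r, hr, e⟩ := h.exists_precomp hψ
    exact ⟨⟨r ≫ q, (preS S).comp_mem _ _ hr hq, r ≫ f⟩, by simpa using e⟩
  ext {X Y Y'} f₁ f₂ p hp e := by
    obtain ⟨X', t, ht, e'⟩ := MorphismProperty.HasRightCalculusOfFractions.ext (W := closureS S)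
      ((proj S).map f₁) ((proj S).map f₂) ((proj S).map p) hp (by simp only [← (proj S).map_comp, e])
    obtain ⟨t, rfl⟩ := (proj S).map_surjective (X := X'.as) t
    rw [← (proj S).map_comp, ← (proj S).map_comp] at e'
    obtain ⟨X'', r, hr, e⟩ := h.exists_precomp e'
    exact ⟨X'', r ≫ t, (preS S).comp_mem _ _ hr ht, by simpa using e⟩

/-- Hence every functor inverting `preS S` factors through the ideal quotient, which yields the
universal property of `Q`. -/
lemma KillsNull.map_eq_of_idealRel (h : KillsNull S) {D : Type*} [Category* D] (F : C ⥤ D)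
    (hF : (preS S).IsInvertedBy F) {X Y : C} (f g : X ⟶ Y) (hfg : idealRel S f g) :
    F.map f = F.map g := by
  obtain ⟨X', q, hq, e⟩ := h.exists_precomp (CategoryTheory.Quotient.sound (idealRel S) hfg)
  have := hF _ hq
  rw [← cancel_epi (F.map q), ← F.map_comp, ← F.map_comp, e]

/-- The functor `Q` is the strict localization of `C` at `preS S`. -/
noncomputable def KillsNull.strictUniversalProperty (h : KillsNull S) (D : Type*) [Category* D] :
    Localization.StrictUniversalPropertyFixedTarget (Q S) (preS S) D where
  inverts _ _ _ hf := (closureS S).Q_inverts _ hf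
  lift F hF := Localization.Construction.lift
    (CategoryTheory.Quotient.lift (idealRel S) F fun _ _ _ _ => h.map_eq_of_idealRel F hF _ _) (by
      intro X Y f hf
      obtain ⟨f, rfl⟩ := (proj S).map_surjective (X := X.as) (Y := Y.as) f
      exact hF f hf)
  fac F hF := (Functor.assoc _ _ _).trans
    ((congrArg (proj S ⋙ ·) (Localization.Construction.fac _ _)).trans
      (CategoryTheory.Quotient.lift_spec _ _ _))
  uniq F₁ F₂ e := Localization.Construction.uniq _ _ (CategoryTheory.Quotient.lift_unique' _ _ _ e)

lemma KillsNull.isLocalization (h : KillsNull S) : (Q S).IsLocalization (preS S) :=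
  Functor.IsLocalization.mk' _ _ (h.strictUniversalProperty _) (h.strictUniversalProperty _)

end Numerators

/-! ### Triples compared with fractions -/

section Triples

variable {C : Type u} [Category.{v} C] [Preadditive C] [HasZeroObject C] [HasBinaryBiproducts C]
  {E : Cᵒᵖ ⥤ C ⥤ AddCommGrpCat.{w}} {S : MorphismProperty C}

/-- The isomorphism of the localization given by a morphism of `closureS S`. -/
noncomputable def toLocIso {X Y : Loc S} (f : under X ⟶ under Y) (hf : closureS S f) : X ≅ Y :=
  have : IsIso (toLoc f) := (closureS S).Q_inverts _ hf
  asIso (toLoc f)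

lemma toLoc_comp {X Y Z : Loc S} (f : under X ⟶ under Y) (g : under Y ⟶ under Z) :
    toLoc (f ≫ g) = toLoc f ≫ toLoc g :=
  (QBar S).map_comp _ _

lemma toLoc_comp_proj {A : Loc S} {X Y : C} (s : under A ⟶ (proj S).obj X) (f : X ⟶ Y) :
    toLoc (Y := (Q S).obj Y) (s ≫ (proj S).map f) =
      toLoc (Y := (Q S).obj X) s ≫ (Q S).map f :=
  (QBar S).map_comp _ _

lemma toLoc_proj_comp {Z : Loc S} {X Y : C} (f : X ⟶ Y) (t : (proj S).obj Y ⟶ under Z) :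
    toLoc (X := (Q S).obj X) ((proj S).map f ≫ t) =
      (Q S).map f ≫ toLoc (X := (Q S).obj Y) t :=
  (QBar S).map_comp _ _

/-- The fraction of a triple. -/
noncomputable abbrev Triple.toFrac {Z₀ A₀ : Loc S} (τ : Triple E Z₀ A₀) : Frac (Q S) E Z₀ A₀ where
  Z := τ.Z
  X := τ.X
  t := toLocIso (X := (Q S).obj τ.Z) τ.t τ.ht
  δ := τ.δ
  s := toLocIso (Y := (Q S).obj τ.X) τ.s τ.hs

variable [IsSumClosed S] [(closureS S).HasLeftCalculusOfFractions]
  [(closureS S).HasRightCalculusOfFractions]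

/-- The killing morphism `r` is absorbed into the right denominators. -/
lemma TripleRel.over {Z₀ A₀ : Loc S} {τ₁ τ₂ : Triple E Z₀ A₀} (h : TripleRel τ₁ τ₂) :
    Over (preS S) (𝟙 _) (𝟙 _) τ₁.toFrac τ₂.toFrac := by
  obtain ⟨Z, X, v₁, v₂, u₁, u₂, hv₁, hv₂, hu₁, hu₂, ht, hs, X', r, hr, e⟩ := h
  have hs' : τ₁.s ≫ (proj S).map (u₁ ≫ r) = τ₂.s ≫ (proj S).map (u₂ ≫ r) := by
    rw [(proj S).map_comp, (proj S).map_comp, ← Category.assoc, ← Category.assoc, hs]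
  refine ⟨Z, X', v₂, v₁, u₂ ≫ r, u₁ ≫ r, hv₂, (preS S).comp_mem _ _ hu₂ hr, ?_, ?_, ?_⟩
  · rw [Category.comp_id]
    exact (toLoc_proj_comp v₂ τ₂.t).symm.trans
      ((congrArg (toLoc (X := (Q S).obj Z)) ht.symm).trans (toLoc_proj_comp v₁ τ₁.t))
  · rw [Category.id_comp]
    exact (toLoc_comp_proj τ₁.s (u₁ ≫ r)).symm.trans
      ((congrArg (toLoc (Y := (Q S).obj X')) hs').trans (toLoc_comp_proj τ₂.s (u₂ ≫ r)))
  · rw [push_sub, sub_eq_zero, push_pull, push_pull, ← push_comp, ← push_comp] at e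
    exact e.symm

/-- The numerators `c` and `a` need not be denominators. Once the triangles commute in the ideal
quotient, 2-out-of-3 puts `q ≫ c` and `a ≫ p` in `preS S`. -/
lemma TripleRel.of_over [(closureS S).HasTwoOutOfThreeProperty] {Z₀ A₀ : Loc S}
    {τ₁ τ₂ : Triple E Z₀ A₀} (h : Over (preS S) (𝟙 _) (𝟙 _) τ₁.toFrac τ₂.toFrac) :
    TripleRel τ₁ τ₂ := by
  obtain ⟨t₁, ht₁, δ₁, s₁, hs₁⟩ := τ₁
  obtain ⟨t₂, ht₂, δ₂, s₂, hs₂⟩ := τ₂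
  obtain ⟨Z, X, v, c, u, a, hv, hu, hc, ha, e⟩ := h
  dsimp only at v c u a e
  have hc' : (QBar S).map ((proj S).map v ≫ t₂) = (QBar S).map ((proj S).map c ≫ t₁) := by
    rw [Category.comp_id] at hc
    exact (toLoc_proj_comp v t₂).trans (hc.trans (toLoc_proj_comp c t₁).symm)
  have ha' : (QBar S).map (s₁ ≫ (proj S).map a) = (QBar S).map (s₂ ≫ (proj S).map u) := by
    rw [Category.id_comp] at ha
    exact (toLoc_comp_proj s₁ a).trans (ha.trans (toLoc_comp_proj s₂ u).symm)
  obtain ⟨⟨Z'⟩, q, hq, hq'⟩ :=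
    (MorphismProperty.map_eq_iff_precomp (QBar S) (closureS S) _ _).1 hc'
  obtain ⟨⟨X'⟩, p, hp, hp'⟩ :=
    (MorphismProperty.map_eq_iff_postcomp (QBar S) (closureS S) _ _).1 ha'
  obtain ⟨q, rfl⟩ := (proj S).map_surjective (X := Z') q
  obtain ⟨p, rfl⟩ := (proj S).map_surjective (Y := X') p
  have hqv : closureS S ((proj S).map (q ≫ v)) := (preS S).comp_mem _ _ hq hv
  have hup : closureS S ((proj S).map (u ≫ p)) := (preS S).comp_mem _ _ hu hp
  have h₁ : (proj S).map (q ≫ c) ≫ t₁ = (proj S).map (q ≫ v) ≫ t₂ := by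
    rw [(proj S).map_comp, (proj S).map_comp, Category.assoc, Category.assoc]
    exact hq'.symm
  have h₂ : s₁ ≫ (proj S).map (a ≫ p) = s₂ ≫ (proj S).map (u ≫ p) := by
    rw [(proj S).map_comp, (proj S).map_comp, ← Category.assoc, ← Category.assoc]
    exact hp'
  refine ⟨Z', X', q ≫ c, q ≫ v, a ≫ p, u ≫ p,
    (closureS S).of_postcomp _ _ ht₁ (h₁ ▸ (closureS S).comp_mem _ _ hqv ht₂), hqv,
    (closureS S).of_precomp _ _ hs₁ (h₂ ▸ (closureS S).comp_mem _ _ hs₂ hup), hup, h₁, h₂,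
    X', 𝟙 _, (preS S).id_mem _, ?_⟩
  rw [push_id, push_comp, push_comp, pull_comp, pull_comp, ← push_pull (c := v), e,
    push_pull (c := c), sub_self]

end Triples

/-! ### The localized bifunctor and realization, and the theorem -/

section Main

variable {C : Type u} [Category.{v} C] [Preadditive C] [HasZeroObject C] [HasBinaryBiproducts C]
  {E : Cᵒᵖ ⥤ C ⥤ AddCommGrpCat.{w}} {S : MorphismProperty C} [IsSumClosed S]
  [(closureS S).HasTwoOutOfThreeProperty] [(closureS S).HasLeftCalculusOfFractions]
  [(closureS S).HasRightCalculusOfFractions] [(Q S).IsLocalization (preS S)]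
  [(preS S).HasLeftCalculusOfFractions] [(preS S).HasRightCalculusOfFractions]

variable (E S) in
/-- The classes of triples are the classes of fractions. -/
noncomputable def locExtEquiv (Z A : Loc S) :
    LocExt E Z A ≃ Ext (locBifunctor (Q S) E (preS S)) Z A :=
  Equiv.ofBijective (Quot.lift (fun τ => lmk τ.toFrac) fun _ _ h => LExt.mk_eq_iff.2 h.over) (by
    constructor
    · rintro ⟨τ₁⟩ ⟨τ₂⟩ h
      exact Quot.sound (.of_over (LExt.mk_eq_iff.1 h))
    · intro θ
      -- With identities as reference isomorphisms, the ends `q` and `p` lie in `preS S`, so the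
      -- fraction comes from a triple.
      obtain ⟨Z', A', q, p, hq, hp, δ, rfl⟩ := exists_lmk (Q := Q S)
        (Iso.refl ((Q S).obj (under Z).as)) (Iso.refl ((Q S).obj (under A).as)) θ
      refine ⟨Quot.mk _ { t := (proj S).map q, ht := hq, δ := δ, s := (proj S).map p, hs := hp }, ?_⟩
      rw [Iso.refl_trans, Iso.trans_refl]
      rfl)

lemma locExtEquiv_cls {Z A : Loc S} (τ : Triple E Z A) :
    locExtEquiv E S Z A τ.cls = lmk τ.toFrac := rfl

variable (S) in
/-- The localized bifunctor. -/
noncomputable def localizedBifunctor (hE : IsBiadditive E) : LocalizedBifunctor E S where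
  functor := locBifunctor (Q S) E (preS S)
  equiv := locExtEquiv E S
  biadditive := locBifunctor_biadditive hE
  add_eq t ht s hs δ₁ δ₂ := LExt.mk_add_mk _ _ _ _
  push_eq {Z₀ A₀ A₁ D} α a u hu hα τ X' a' s' hs' e := by
    rw [locExtEquiv_cls, locExtEquiv_cls]
    refine push_lmk (a := a') ?_ τ.δ
    have h₁ := toLoc_comp_proj τ.s a'
    have h₂ := toLoc_comp (Z := (Q S).obj X') a s'
    have h₃ := toLoc_comp (Z := (Q S).obj X') u s'
    refine h₁.symm.trans ((congrArg (toLoc (Y := (Q S).obj X')) e).trans (h₂.trans ?_))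
    rw [← hα, Category.assoc]
    exact congrArg (α ≫ ·) h₃.symm
  pull_eq {A₀ Z₀ Z₁ D} γ c v hv hγ τ Z' c' t' ht' e := by
    rw [locExtEquiv_cls, locExtEquiv_cls]
    refine pull_lmk (c := c') ?_ τ.δ
    have h₁ := toLoc_proj_comp c' τ.t
    have h₂ := toLoc_comp (X := (Q S).obj Z') t' c
    have h₃ := toLoc_comp (X := (Q S).obj Z') t' v
    refine Eq.trans ?_ (h₂.symm.trans ((congrArg (toLoc (X := (Q S).obj Z')) e.symm).trans h₁))
    rw [← hγ, ← Category.assoc]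
    exact congrArg (· ≫ γ) h₃

/-- Both relations contain the standard sequence of each triple, and `LocSeq` is a class assignment,
so both consist of the sequences equivalent to it. -/
lemma localizedBifunctor_realization {s : Realization E} (hC : IsWeaklyExtriangulated E s)
    (hk : KilledSymm (E := E) (preS S)) :
    (localizedBifunctor S hC.biadditive).realization s = LocSeq (Q S) (preS S) s := by
  have hstd {A Z : Loc S} (τ : Triple E Z A) {Y : C} {f : τ.X ⟶ Y} {g : Y ⟶ τ.Z} (h : s f g τ.δ) :
      LocSeq (Q S) (preS S) s
        (toLoc (S := S) (Y := (Q S).obj Y) (τ.s ≫ (proj S).map f))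
        (toLoc (S := S) (X := (Q S).obj Y) ((proj S).map g ≫ τ.t)) (lmk τ.toFrac) := by
    exact Eq.mpr (congrArg₂ (LocSeq (Q S) (preS S) s · · (lmk τ.toFrac)) (toLoc_comp_proj τ.s f)
      (toLoc_proj_comp g τ.t)) (LocSeq.of_frac τ.toFrac h)
  have hassign := LocSeq.isClassAssignment (Q := Q S) (W := preS S) hC hk
  funext A B Z x y θ
  apply propext
  constructor
  · rintro ⟨τ, hτ, Y, f, g, h, hxy⟩
    obtain rfl : lmk τ.toFrac = θ := (Equiv.eq_symm_apply _).1 hτ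
    exact (hassign.iff_equiv (hstd τ h) _ _).2 hxy
  · intro h
    obtain ⟨τ, hτ⟩ := Quot.exists_rep ((locExtEquiv E S Z A).symm θ)
    obtain rfl : lmk τ.toFrac = θ := (Equiv.eq_symm_apply (locExtEquiv E S Z A)).1 hτ
    obtain ⟨Y, f, g, hfg⟩ := hC.assignment.exists_seq τ.δ
    exact ⟨τ, hτ, Y, f, g, hfg, (hassign.iff_equiv (hstd τ hfg) _ _).1 h⟩

lemma LiftsToMiddle.killedSymm {s : Realization E} (h : LiftsToMiddle S s)
    (hC : IsWeaklyExtriangulated E s) : KilledSymm (E := E) (preS S) :=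
  .of_lifts (Q := Q S) hC fun {A B Z A' B' Z'} x y δ x' y' δ' a c hs hs' e ha hc => by
    obtain ⟨b, hb, hx, hy⟩ := h x y δ x' y' δ' a c hs hs' e ha hc
    refine ⟨toLocIso (X := (Q S).obj B) (Y := (Q S).obj B') b hb, ?_, ?_⟩
    · exact ((QBar S).map_comp _ _).symm.trans
        ((congrArg (QBar S).map hx).trans ((QBar S).map_comp _ _))
    · exact ((QBar S).map_comp _ _).symm.trans
        ((congrArg (QBar S).map hy).trans ((QBar S).map_comp _ _))

/-- The middle morphism `p` joins the second factor for inflations and the first for deflations;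
either way it is an outer factor in `closureS S`. -/
lemma compStable_of_bar {s : Realization E} (hInf : (barInf S s).IsStableUnderComposition)
    (hDef : (barDef S s).IsStableUnderComposition) : CompStable (Q S) (preS S) s where
  inflation {X Y X' Y'} f p f' hf hp hf' := by
    have h₁ : barInf S s ((proj S).map f) :=
      ⟨X, Y, 𝟙 _, f, 𝟙 _, hf, (closureS S).id_mem _, (closureS S).id_mem _, by simp⟩
    have h₂ : barInf S s ((proj S).map p ≫ (proj S).map f') :=
      ⟨X', Y', (proj S).map p, f', 𝟙 _, hf', hp, (closureS S).id_mem _, by simp⟩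
    obtain ⟨A, B, u, x, v, hx, hu, hv, e⟩ := hInf.comp_mem _ _ h₁ h₂
    refine ⟨A, B, toLocIso (X := (Q S).obj X) (Y := (Q S).obj A) u hu, x,
      toLocIso (X := (Q S).obj B) (Y := (Q S).obj Y') v hv, hx, ?_⟩
    have e' := congrArg (QBar S).map e
    simp only [Functor.map_comp] at e'
    exact e'
  deflation {X Y X' Y'} f p f' hf hp hf' := by
    have h₁ : barDef S s ((proj S).map f ≫ (proj S).map p) :=
      ⟨X, Y, 𝟙 _, f, (proj S).map p, hf, (closureS S).id_mem _, hp, by simp⟩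
    have h₂ : barDef S s ((proj S).map f') :=
      ⟨X', Y', 𝟙 _, f', 𝟙 _, hf', (closureS S).id_mem _, (closureS S).id_mem _, by simp⟩
    obtain ⟨A, B, u, x, v, hx, hu, hv, e⟩ := hDef.comp_mem _ _ h₁ h₂
    refine ⟨A, B, toLocIso (X := (Q S).obj X) (Y := (Q S).obj A) u hu, x,
      toLocIso (X := (Q S).obj B) (Y := (Q S).obj Y') v hv, hx, ?_⟩
    have e' := congrArg (QBar S).map e
    simp only [Functor.map_comp, Category.assoc] at e'
    exact e'

end Main

end Extriangulated

theorem corollary3p27 {C : Type u} [Category.{v} C] [Preadditive C] [HasZeroObject C]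
    [HasBinaryBiproducts C] (E : Cᵒᵖ ⥤ C ⥤ AddCommGrpCat.{w}) (s : Realization E)
    (hC : IsExtriangulated E s)
    (S : MorphismProperty C) [IsSumClosed S]
    [(closureS S).HasTwoOutOfThreeProperty]
    [(closureS S).HasLeftCalculusOfFractions] [(closureS S).HasRightCalculusOfFractions]
    (hLift : LiftsToMiddle S s)
    (hInf : (barInf S s).IsStableUnderComposition)
    (hDef : (barDef S s).IsStableUnderComposition)
    (hKer : KernelsAreNull S s) (hKill : KillsNull S) :
    ∃ F : LocalizedBifunctor E S,
      CorrespondsToExact F.functor (F.realization s) ∧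
      ((∀ ⦃A B : C⦄ (f : A ⟶ B), IsAdmissible s f) →
        ∃ h : Abelian (Loc S), h.toPreadditive = (inferInstance : Preadditive (Loc S))) := by
  have := hKill.isLocalization
  have := hKill.hasLeftCalculusOfFractions
  have := hKill.hasRightCalculusOfFractions
  have hk := hLift.killedSymm hC.toIsWeaklyExtriangulated
  have hex : CorrespondsToExact (locBifunctor (Q S) E (preS S)) (LocSeq (Q S) (preS S) s) :=
    LocSeq.correspondsToExact hC hk (compStable_of_bar hInf hDef)
      (fun x f hx hf => by
        rw [Functor.comp_map, proj_map_eq_zero (hKer.inflation x f hx hf), Functor.map_zero])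
      (fun y g hy hg => by
        rw [Functor.comp_map, proj_map_eq_zero (hKer.deflation y g hy hg), Functor.map_zero])
  refine ⟨localizedBifunctor S hC.biadditive, ?_, fun hadm => ?_⟩
  · rw [localizedBifunctor_realization hC.toIsWeaklyExtriangulated hk]
    exact hex
  · exact hex.exists_abelian (LocSeq.isAdmissible hadm)
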